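/- Let $L_{\mathcal O}=\{+,-,0,\mathcal O\}$ with $\mathcal O$ a ternary relation symbol, and let $L_{\mathcal O}^p=L_{\mathcal O}\cup\{V\}$ with $V$ a unary predicate. An *oriented abelian group* is an abelian group $A$ with a strict ternary relation $\mathcal O$ (its arguments are always pairwise distinct) that is cyclic ($\mathcal O(x,y,z)\Rightarrow\mathcal O(y,z,x)$), invariant under translations, and such that $x<_0y :\Leftrightarrow x\ne y\wedge\mathcal O(0,x,y)$ is a strict linear order on $A\setminus\{0\}$. It is *regularly dense* if for every prime $p$ and all $a,b\in A$ with $\mathcal O(0,a,b)$ there is $c\in A$ with $\mathcal O(a,pc,b)$ and $ic<_0(i+1)c$ for all $1\le i\le p-1$. Let $T(\vec 0,\vec 0)$ be the $L_{\mathcal O}$-theory of regularly dense oriented abelian groups $A$ such that for every prime $p$ we have $pA=A$ and $A$ has no nonzero element of $p$-power order (that is, of divisible torsion-free regularly dense oriented abelian groups). Let $T((\vec 0,\vec 0),(\vec 0,\vec 0))$ be the $L_{\mathcal O}^p$-theory whose models are the pairs $(A,G)$, with $V$ interpreted as $G$, such that $A\models T(\vec 0,\vec 0)$, $G$ is a subgroup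 of $A$ with $G\models T(\vec 0,\vec 0)$ for the induced orientation, $G$ is dense in $A$ (it meets every nonempty orientation interval $\{x:\mathcal O(a,x,b)\}$), and $A/G$ is infinite. **Corollary.** The theory $T((\vec 0,\vec 0),(\vec 0,\vec 0))$ has NIP: there are no model $M$ of it and no partitioned $L_{\mathcal O}^p$-formula $\varphi(\vec x;\vec y)$ such that for every $k\in\mathbb N$ there are tuples $(a_i)_{i<k}$ in $M^{|\vec x|}$ and $(b_I)_{I\subseteq\{0,\dots,k-1\}}$ in $M^{|\vec y|}$ with $M\models\varphi(a_i;b_I)\Leftrightarrow i\in I$ for all $i<k$ and $I\subseteq\{0,\dots,k-1\}$. (Equivalently, every partitioned formula has finite VC-dimension in every model.) -/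

import Mathlib

open FirstOrder FirstOrder.Language

universe u v w

namespace OrientedPairs

/-! ### Languages -/

/-- The function symbols `0`, `-` (unary) and `+` of oriented abelian groups. -/
inductive GroupFunc : ℕ → Type
  | zero : GroupFunc 0
  | neg : GroupFunc 1
  | add : GroupFunc 2

/-- The ternary relation symbol for the orientation. -/
inductive OrientRel : ℕ → Type
  | orient : OrientRel 3

/-- The language `L_O = {+, -, 0, O}` of oriented abelian groups. -/
def LO : FirstOrder.Language.{0, 0} := ⟨GroupFunc, OrientRel⟩

/-- The unary relation symbol for the distinguished subgroup. -/
inductive PredRel : ℕ → Type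
  | V : PredRel 1

/-- The language consisting of a single unary predicate `V`. -/
def LV : FirstOrder.Language.{0, 0} := ⟨fun _ => Empty, PredRel⟩

/-- The language `L_O ∪ {V}` of pairs of oriented abelian groups. -/
abbrev LOp : FirstOrder.Language.{0, 0} := LO.sum LV

/-! ### Terms and atomic formulas of `L_O` -/

section Terms

variable {α : Type}

/-- The term `0`. -/
def zeroT : LO.Term α := Constants.term (L := LO) GroupFunc.zero

/-- The term `-t`. -/
def negT (t : LO.Term α) : LO.Term α := Functions.apply₁ (L := LO) GroupFunc.neg t

/-- The term `s + t`. -/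
def addT (s t : LO.Term α) : LO.Term α := Functions.apply₂ (L := LO) GroupFunc.add s t

/-- The term `t + ⋯ + t` with `n` summands. -/
def nsmulT : ℕ → LO.Term α → LO.Term α
  | 0, _ => zeroT
  | n + 1, t => addT (nsmulT n t) t

/-- The atomic formula `O(r, s, t)`. -/
def orientF {n : ℕ} (r s t : LO.Term (α ⊕ Fin n)) : LO.BoundedFormula α n :=
  Relations.boundedFormula (L := LO) OrientRel.orient ![r, s, t]

/-- The formula `s <₀ t`, that is, `s ≠ t ∧ O(0, s, t)`. -/
def ltF {n : ℕ} (s t : LO.Term (α ⊕ Fin n)) : LO.BoundedFormula α n :=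
  ∼(s =' t) ⊓ orientF zeroT s t

end Terms

/-! ### The theory of divisible torsion-free oriented abelian groups -/

/-- The axioms of abelian groups. -/
def groupAxioms : LO.Theory :=
  { ∀' ∀' ∀' (addT (addT (&0) (&1)) (&2) =' addT (&0) (addT (&1) (&2))),
    ∀' ∀' (addT (&0) (&1) =' addT (&1) (&0)),
    ∀' (addT (&0) zeroT =' &0),
    ∀' (addT (&0) (negT (&0)) =' zeroT) }

/-- The axioms of an orientation: `O` is a (strict) cyclic ternary relation, preserved by
translations, and `<₀` is a strict linear order on the nonzero elements. -/
def orientationAxioms : LO.Theory :=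
  { -- `O(x, y, z)` implies `O(y, z, x)`
    ∀' ∀' ∀' (orientF (&0) (&1) (&2) ⟹ orientF (&1) (&2) (&0)),
    -- `O(x, y, z)` implies that `x`, `y`, `z` are pairwise distinct
    ∀' ∀' ∀' (orientF (&0) (&1) (&2) ⟹
      (∼((&0) =' (&1)) ⊓ ∼((&1) =' (&2)) ⊓ ∼((&0) =' (&2)))),
    -- `O(x, y, z)` implies `O(x + w, y + w, z + w)`
    ∀' ∀' ∀' ∀' (orientF (&0) (&1) (&2) ⟹
      orientF (addT (&0) (&3)) (addT (&1) (&3)) (addT (&2) (&3))),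
    -- `x <₀ y` and `y <₀ z` imply `x <₀ z`
    ∀' ∀' ∀' (ltF (&0) (&1) ⟹ ltF (&1) (&2) ⟹ ltF (&0) (&2)),
    -- distinct nonzero `x`, `y` satisfy `x <₀ y` or `y <₀ x`
    ∀' ∀' (∼((&0) =' zeroT) ⟹ ∼((&1) =' zeroT) ⟹ ∼((&0) =' (&1)) ⟹
      (ltF (&0) (&1) ⊔ ltF (&1) (&0))) }

/-- Regular density at `p`: whenever `O(0, a, b)`, there is `c` with `O(a, p c, b)` and
`i c <₀ (i + 1) c` for all `i ∈ {1, …, p - 1}`. -/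
noncomputable def regDenseAxiom (p : ℕ) : LO.Sentence :=
  ∀' ∀' (orientF zeroT (&0) (&1) ⟹
    ∃' (orientF (&0) (nsmulT p (&2)) (&1) ⊓
      BoundedFormula.iInf (fun i : Set.Icc 1 (p - 1) =>
        ltF (nsmulT i (&2)) (nsmulT (i + 1) (&2)))))

/-- `p`-divisibility, `pA = A` (that is, the index of `pA` in `A` is `p ^ 0`). -/
def divAxiom (p : ℕ) : LO.Sentence :=
  ∀' ∃' (nsmulT p (&1) =' &0)

/-- There is no nonzero `n`-torsion. -/
def torsionFreeAxiom (n : ℕ) : LO.Sentence :=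
  ∀' ((nsmulT n (&0) =' zeroT) ⟹ ((&0) =' zeroT))

/-- The `L_O`-theory `T(0, 0)`: its models are the regularly dense oriented abelian groups `A`
such that, for every prime `p`, `pA = A` and every `p ^ k`-torsion subgroup is trivial. -/
def divTorsionFreeTheory : LO.Theory :=
  groupAxioms ∪ orientationAxioms ∪
    {φ | ∃ p : ℕ, p.Prime ∧ φ = regDenseAxiom p} ∪
    {φ | ∃ p : ℕ, p.Prime ∧ φ = divAxiom p} ∪
    {φ | ∃ p k : ℕ, p.Prime ∧ φ = torsionFreeAxiom (p ^ k)}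

/-! ### The theory of pairs -/

/-- The atomic formula `V(t)`. -/
def predF {α : Type} {n : ℕ} (t : LOp.Term (α ⊕ Fin n)) : LOp.BoundedFormula α n :=
  Relations.boundedFormula₁ (L := LOp) (Sum.inr PredRel.V) t

/-- The `V`-restriction of a formula: all quantifiers are restricted to `V`. -/
def restrictV {α : Type} : {n : ℕ} → LOp.BoundedFormula α n → LOp.BoundedFormula α n
  | _, .falsum => .falsum
  | _, .equal s t => .equal s t
  | _, .rel R ts => .rel R ts
  | _, .imp φ ψ => (restrictV φ).imp (restrictV ψ)
  | n, .all φ => ∀' (predF (Term.var (Sum.inr (Fin.last n))) ⟹ restrictV φ)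

/-- The inclusion of `L_O` into the language of pairs. -/
abbrev incl : LO →ᴸ LOp := LHom.sumInl

/-- `V` is a subgroup. -/
def subgroupAxioms : LOp.Theory :=
  { predF (incl.onTerm zeroT),
    ∀' (predF (&0) ⟹ predF (incl.onTerm (negT (&0)))),
    ∀' ∀' (predF (&0) ⟹ predF (&1) ⟹ predF (incl.onTerm (addT (&0) (&1)))) }

/-- `V` is dense: it meets every nonempty orientation interval `(a, b)_O`. -/
def denseAxiom : LOp.Sentence :=
  ∀' ∀' ((∃' incl.onBoundedFormula (orientF (&0) (&2) (&1))) ⟹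
    ∃' (predF (&2) ⊓ incl.onBoundedFormula (orientF (&0) (&2) (&1))))

/-- There are at least `n` cosets of `V`: some `x₀, …, xₙ₋₁` satisfy `¬ V(xᵢ - xⱼ)` for all
`i ≠ j`. -/
noncomputable def indexGeAxiom (n : ℕ) : LOp.Sentence :=
  BoundedFormula.exs (n := n)
    (BoundedFormula.iInf (fun ij : {ij : Fin n × Fin n // ij.1 ≠ ij.2} =>
      ∼(predF (incl.onTerm (addT (Term.var (Sum.inr ij.1.1)) (negT (Term.var (Sum.inr ij.1.2))))))))

/-- The theory `T((0, 0), (0, 0))` of pairs `(A, G)`: `A` and `G` are models of `T(0, 0)`, `G` is a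
dense subgroup of `A` and `A / G` is infinite. -/
def pairTheory : LOp.Theory :=
  incl.onTheory divTorsionFreeTheory ∪
    restrictV '' incl.onTheory divTorsionFreeTheory ∪
    subgroupAxioms ∪ {denseAxiom} ∪ Set.range indexGeAxiom

/-! ### The independence property -/

/-- The partitioned formula `φ(x; y)`, with `|x| = m` and `|y| = n`, has the independence property
in `M`: for every `k` there are tuples `a i`, for `i < k`, and `b I`, for `I ⊆ {0, …, k - 1}`, such
that `φ(a i; b I)` holds in `M` exactly when `i ∈ I`. -/
def HasIP {L : FirstOrder.Language.{u, v}} (M : Type w) [L.Structure M] {m n : ℕ}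
    (φ : L.Formula (Fin m ⊕ Fin n)) : Prop :=
  ∀ k : ℕ, ∃ (a : Fin k → Fin m → M) (b : Set (Fin k) → Fin n → M),
    ∀ (i : Fin k) (I : Set (Fin k)), φ.Realize (Sum.elim (a i) (b I)) ↔ i ∈ I

/-- The theory `T` has NIP: no partitioned formula has the independence property in a model of
`T`. -/
def NIP {L : FirstOrder.Language.{u, v}} (T : L.Theory) : Prop :=
  ∀ (M : Type w) [L.Structure M] [M ⊨ T] [Nonempty M] (m n : ℕ) (φ : L.Formula (Fin m ⊕ Fin n)),
    ¬ HasIP M φ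

end OrientedPairs

/-! An oriented abelian group `A` is unrolled, like a circle to a line, into a linearly ordered
group `B` with a positive element `one` such that `A = B / ℤ one`. As a set `B = ℤ × A`, with
addition twisted by a carry and lexicographic order; `[0, one)` is a copy of `A`. For a model `(A,
G)` of the pair theory let `H` be the preimage of `G` in `B`. Divisibility, torsion-freeness and
regular density become (`isDensePair`): `B = N B + ℤ one`, `H` is pure of infinite index, and `N H`
is dense in `B` for every `N > 0`.

Lift tuples of `A` to `[0, one)` and adjoin `one`. Every atomic formula then speaks of finitely many
integer combinations of the lifted tuple: whether they are positive or lie in `H`. For quantifiers,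
conditions of divisibility by `N` are added and a back-and-forth is run with bounded coefficients:
agreement up to a large bound `E` lets any new element be matched with agreement up to `C`
(`exists_extension`). A new element whose multiples avoid the relevant combinations has independent
data: its pattern relative to `H`, its residue modulo `L B`, and its cut. Hence each formula depends
on finitely many such conditions (`exists_bound`).

NIP follows by counting. On a pair `(a i, b I)` each combination splits as `f i + g I`. As `I`
varies, a sign condition cuts out a chain of subsets of `Fin k`, and a condition modulo a subgroup
cuts out classes of one equivalence relation or the empty set; either way at most `k + 1` subsets.
With `N` conditions, independence would give `2 ^ k ≤ (k + 1) ^ N` for all `k`, which is absurd. -/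

namespace OrientedPairs

/-! ### Orientations and the associated linear order -/

/-- `O` is an orientation of the abelian group `A`. -/
structure IsOrientation {A : Type*} [AddCommGroup A] (O : A → A → A → Prop) : Prop where
  cyc : ∀ {x y z}, O x y z → O y z x
  ne : ∀ {x y z}, O x y z → x ≠ y ∧ y ≠ z ∧ x ≠ z
  add : ∀ {x y z} w, O x y z → O (x + w) (y + w) (z + w)
  trans : ∀ {x y z}, O 0 x y → O 0 y z → O 0 x z
  total : ∀ {x y}, x ≠ 0 → y ≠ 0 → x ≠ y → O 0 x y ∨ O 0 y x

namespace IsOrientation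

variable {A : Type*} [AddCommGroup A] {O : A → A → A → Prop}

theorem add_iff (h : IsOrientation O) (x y z w : A) :
    O (x + w) (y + w) (z + w) ↔ O x y z := by
  refine ⟨fun H => ?_, h.add w⟩
  simpa using h.add (-w) H

theorem base (h : IsOrientation O) (x y z : A) : O x y z ↔ O 0 (y - x) (z - x) := by
  rw [← h.add_iff x y z (-x)]
  simp [sub_eq_add_neg]

theorem asymm (h : IsOrientation O) {x y z : A} (H : O x y z) : ¬ O x z y := by
  rw [h.base] at H ⊢
  intro H'
  exact (h.ne (h.trans H H')).2.1 rfl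

theorem total' (h : IsOrientation O) {x y z : A} (hxy : x ≠ y) (hyz : y ≠ z) (hxz : x ≠ z) :
    O x y z ∨ O x z y := by
  rw [h.base x y z, h.base x z y]
  exact h.total (sub_ne_zero.2 hxy.symm) (sub_ne_zero.2 hxz.symm) (by simpa using hyz)

theorem trans' (h : IsOrientation O) {t x y z : A} (H : O t x y) (H' : O t y z) : O t x z := by
  rw [h.base] at H H' ⊢
  exact h.trans H H'

/-- Otherwise `O x z y`; rotating so that `y` is the base point, transitivity yields `O y t z`,
against `O t y z`. -/
theorem of_base (h : IsOrientation O) {t x y z : A} (H : O t x y) (H' : O t y z) : O x y z := by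
  have h1 := h.ne H
  have h2 := h.ne H'
  have h3 := h.trans' H H'
  rcases h.total' h1.2.1 h2.2.1 (h.ne h3).2.1 with h4 | h4
  · exact h4
  · exact absurd (h.trans' (h.cyc (h.cyc H)) (h.cyc (h.cyc h4))) (h.asymm (h.cyc H'))

/-- The strict linear order on `A` with least element `0` induced by an orientation. -/
def lt (_h : IsOrientation O) (x y : A) : Prop := (x = 0 ∧ y ≠ 0) ∨ O 0 x y

open Classical in
/-- The linear order on `A` with least element `0` induced by an orientation. -/
noncomputable abbrev linearOrder (h : IsOrientation O) : LinearOrder A where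
  le x y := x = y ∨ h.lt x y
  lt := h.lt
  le_refl x := Or.inl rfl
  le_trans x y z := by
    have := @h.trans x y z
    have := @h.ne 0 x y
    have := @h.ne 0 y z
    unfold lt
    grind
  lt_iff_le_not_ge x y := by
    have := h.asymm (x := 0) (y := x) (z := y)
    have := @h.ne 0 x y
    have := @h.ne 0 y x
    unfold lt
    grind
  le_antisymm x y := by
    have := h.asymm (x := 0) (y := x) (z := y)
    have := @h.ne 0 x y
    have := @h.ne 0 y x
    unfold lt
    grind
  le_total x y := by
    have := @h.total x y
    unfold lt
    grind
  toDecidableLE := Classical.decRel _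
  toDecidableEq := Classical.decEq _
  toDecidableLT := Classical.decRel _

/-- Increasing triples are oriented by `of_base`. Conversely, if no rotation of a triple of distinct
points is increasing, some rotation of the reversed triple is, and asymmetry applies. -/
theorem iff_lt (h : IsOrientation O) (x y z : A) : O x y z ↔
    (h.lt x y ∧ h.lt y z) ∨ (h.lt y z ∧ h.lt z x) ∨ (h.lt z x ∧ h.lt x y) := by
  let := h.linearOrder
  have key : ∀ {x y z : A}, h.lt x y → h.lt y z → O x y z := by
    intro x y z hxy hyz
    rcases hyz with ⟨rfl, -⟩ | hyz
    · rcases hxy with ⟨-, hxy⟩ | hxy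
      · exact absurd rfl hxy
      · exact absurd rfl (h.ne hxy).2.2
    rcases hxy with ⟨rfl, -⟩ | hxy
    · exact hyz
    · exact h.of_base hxy hyz
  constructor
  · intro H
    obtain ⟨n1, n2, n3⟩ := h.ne H
    have t1 : h.lt x y ∨ h.lt y x := lt_or_gt_of_ne n1
    have t2 : h.lt y z ∨ h.lt z y := lt_or_gt_of_ne n2
    have t3 : h.lt x z ∨ h.lt z x := lt_or_gt_of_ne n3
    have a1 : ¬ O x z y := h.asymm H
    have k1 := fun p q => a1 (@key x z y p q)
    have k2 := fun p q => a1 (h.cyc (h.cyc (@key z y x p q)))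
    have k3 := fun p q => a1 (h.cyc (@key y x z p q))
    tauto
  · rintro (⟨p, q⟩ | ⟨p, q⟩ | ⟨p, q⟩)
    · exact key p q
    · exact h.cyc (h.cyc (key p q))
    · exact h.cyc (key p q)

theorem lt_add_iff (h : IsOrientation O) (x y c : A) :
    h.lt x y ↔ (c + x = c ∧ c + y ≠ c) ∨ O c (c + x) (c + y) := by
  rw [h.base c]
  simp [lt]

open Classical in
/-- The carry of an addition. -/
noncomputable def carry (h : IsOrientation O) (x y : A) : ℤ := if h.lt (x + y) x then 1 else 0

end IsOrientation

/-! ### The universal cover -/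

/-- The universal cover of an oriented abelian group: a linearly ordered abelian group which is
an extension of `A` by `ℤ`. -/
@[ext]
structure Cover {A : Type*} [AddCommGroup A] {O : A → A → A → Prop} (h : IsOrientation O) where
  int : ℤ
  pt : A

namespace Cover

variable {A : Type*} [AddCommGroup A] {O : A → A → A → Prop} {h : IsOrientation O}

noncomputable instance : Zero (Cover h) := ⟨⟨0, 0⟩⟩
noncomputable instance : Add (Cover h) := ⟨fun x y => ⟨x.int + y.int + h.carry x.pt y.pt, x.pt + y.pt⟩⟩
noncomputable instance : Neg (Cover h) := ⟨fun x => ⟨-x.int - h.carry x.pt (-x.pt), -x.pt⟩⟩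

@[simp] theorem zero_int : (0 : Cover h).int = 0 := rfl
@[simp] theorem zero_pt : (0 : Cover h).pt = 0 := rfl
theorem add_int (x y : Cover h) : (x + y).int = x.int + y.int + h.carry x.pt y.pt := rfl
@[simp] theorem add_pt (x y : Cover h) : (x + y).pt = x.pt + y.pt := rfl
theorem neg_int (x : Cover h) : (-x).int = -x.int - h.carry x.pt (-x.pt) := rfl
@[simp] theorem neg_pt (x : Cover h) : (-x).pt = -x.pt := rfl

end Cover

/-! ### The carry: cocycle identities and compatibility with the order. -/

namespace IsOrientation

variable {A : Type*} [AddCommGroup A] {O : A → A → A → Prop}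

theorem not_lt_zero (h : IsOrientation O) (x : A) : ¬ h.lt x 0 := by
  let := h.linearOrder
  intro H
  rcases eq_or_ne x 0 with rfl | hx
  · exact lt_irrefl (0 : A) H
  · exact lt_asymm (α := A) H (Or.inl ⟨rfl, hx⟩)

theorem carry_zero (h : IsOrientation O) (x : A) : h.carry x 0 = 0 := by
  let := h.linearOrder
  have : ¬ h.lt x x := lt_irrefl (α := A) x
  simp [carry, this]

theorem zero_carry (h : IsOrientation O) (x : A) : h.carry 0 x = 0 := by
  simp [carry, h.not_lt_zero]

/-- If `x + y` fell below `x` but not below `y`, translating these two relations would give the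
impossible chain `x < -y < -(x + y) < -x < y < x + y < x`. -/
theorem carry_comm (h : IsOrientation O) (x y : A) : h.carry x y = h.carry y x := by
  let := h.linearOrder
  have key : ∀ x y : A, h.lt (x + y) x → h.lt (x + y) y := by
    intro x y H
    rcases H with ⟨H0, H1⟩ | H
    · left
      refine ⟨H0, ?_⟩
      rintro rfl
      simp at H0
      exact H1 H0
    · right
      by_contra hc
      have hne := h.ne H
      have y0 : y ≠ 0 := by rintro rfl; simp at hne
      have x0 : x ≠ 0 := hne.2.2.symm
      have hys : O 0 y (x + y) :=
        (h.total hne.1.symm y0 (by simpa using x0)).resolve_left hc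
      have h1 : O 0 x (-y) := by simpa using h.cyc (h.add (-y) hys)
      have h2 : O 0 (-y) (-(x + y)) := by
        simpa using h.cyc (h.add (-(x + y)) H)
      have h3 : O 0 (-(x + y)) (-x) := by simpa using h.cyc (h.cyc (h.add (-(x + y)) hys))
      have h4 : O 0 (-x) y := by simpa using h.cyc (h.cyc (h.add (-x) H))
      have h5 := h.trans (h.trans h1 h2) (h.trans h3 h4)
      exact (h.ne (h.trans (h.trans h5 hys) H)).2.1 rfl
  have : h.lt (x + y) x ↔ h.lt (y + x) y := by
    constructor
    · intro H; rw [add_comm y x]; exact key x y H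
    · intro H; rw [add_comm x y]; exact key y x H
  unfold carry
  classical exact if_congr this rfl rfl

/-- The cocycle identity as a statement on three points of a linear order, with `s = a + b` and `r =
a + b + c`. The long disjunction is `b + c < b` seen from base point `a`, through `lt_add_iff` and
`iff_lt`. -/
theorem carry_assoc_aux {A : Type*} [LinearOrder A] (a r s : A)
    [Decidable ((r = a ∧ s ≠ a) ∨ (a < r ∧ r < s) ∨ (r < s ∧ s < a) ∨ (s < a ∧ a < r))] :
    (if s < a then (1 : ℤ) else 0) + (if r < s then 1 else 0) =
    (if (r = a ∧ s ≠ a) ∨ (a < r ∧ r < s) ∨ (r < s ∧ s < a) ∨ (s < a ∧ a < r) then 1 else 0) +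
    (if r < a then 1 else 0) := by
  split_ifs <;> grind

theorem carry_add_mono_aux {A : Type*} [LinearOrder A] {c p q : A}
    (H : (p = c ∧ q ≠ c) ∨ (c < p ∧ p < q) ∨ (p < q ∧ q < c) ∨ (q < c ∧ c < p)) :
    (if p < c then (1 : ℤ) else 0) < (if q < c then 1 else 0) ∨
    ((if p < c then (1 : ℤ) else 0) = (if q < c then 1 else 0) ∧ p < q) := by
  split_ifs <;> grind

theorem carry_step_aux {A : Type*} [LinearOrder A] (c p q : A) :
    (if p < c then (1 : ℤ) else 0) < (if q < c then 1 else 0) + 1 ∨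
    ((if p < c then (1 : ℤ) else 0) = (if q < c then 1 else 0) + 1 ∧ p < q) := by
  split_ifs <;> grind

theorem carry_assoc (h : IsOrientation O) (a b c : A) :
    h.carry a b + h.carry (a + b) c = h.carry b c + h.carry a (b + c) := by
  let := h.linearOrder
  have e : h.lt (b + c) b ↔ (a + b + c = a ∧ a + b ≠ a) ∨ O a (a + b + c) (a + b) := by
    rw [h.lt_add_iff _ _ a, add_assoc]
  rw [h.iff_lt] at e
  unfold carry
  rw [← add_assoc a b c]
  classical
  rw [if_congr e rfl rfl]
  exact @carry_assoc_aux A h.linearOrder a (a + b + c) (a + b) _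

theorem carry_add_mono (h : IsOrientation O) {x y : A} (c : A) (H : h.lt x y) :
    h.carry c x < h.carry c y ∨ (h.carry c x = h.carry c y ∧ h.lt (c + x) (c + y)) := by
  let := h.linearOrder
  rw [h.lt_add_iff x y c, h.iff_lt] at H
  unfold carry
  classical
  exact @carry_add_mono_aux A h.linearOrder _ _ _ H

/-- Serves elements of the cover with different integer parts. The carry drops by at most one, and
if it drops then `c + x < c ≤ c + y`. -/
theorem carry_step (h : IsOrientation O) (x y c : A) :
    h.carry c x < h.carry c y + 1 ∨ (h.carry c x = h.carry c y + 1 ∧ h.lt (c + x) (c + y)) := by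
  let := h.linearOrder
  unfold carry
  classical
  exact @carry_step_aux A h.linearOrder c (c + x) (c + y)

end IsOrientation

/-! ### The cover as a linearly ordered group over `A`. -/

namespace Cover

variable {A : Type*} [AddCommGroup A] {O : A → A → A → Prop} {h : IsOrientation O}

noncomputable instance : AddCommGroup (Cover h) where
  add_assoc x y z := by
    ext
    · have := h.carry_assoc x.pt y.pt z.pt
      simp only [add_int, add_pt]
      linarith
    · simp [add_assoc]
  zero_add x := by
    ext <;> simp [add_int, h.zero_carry]
  add_zero x := by
    ext <;> simp [add_int, h.carry_zero]
  add_comm x y := by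
    ext
    · simp only [add_int, h.carry_comm x.pt y.pt]
      ring
    · simp [add_comm]
  neg_add_cancel x := by
    ext
    · simp only [add_int, neg_int, neg_pt, zero_int, h.carry_comm (-x.pt)]
      ring
    · simp
  nsmul := nsmulRec
  zsmul := zsmulRec

noncomputable instance : LinearOrder (Cover h) :=
  letI := h.linearOrder
  LinearOrder.lift' (fun x : Cover h => toLex (x.int, x.pt)) (by
    intro x y hxy
    have := congrArg ofLex hxy
    simp only [ofLex_toLex, Prod.mk.injEq] at this
    exact Cover.ext this.1 this.2)

theorem lt_iff (x y : Cover h) : x < y ↔ x.int < y.int ∨ (x.int = y.int ∧ h.lt x.pt y.pt) := by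
  let := h.linearOrder
  exact Prod.Lex.toLex_lt_toLex (x := (x.int, x.pt)) (y := (y.int, y.pt))

theorem add_lt_add_left' {x y : Cover h} (H : x < y) (c : Cover h) : c + x < c + y := by
  rw [lt_iff] at H ⊢
  simp only [add_int, add_pt]
  rcases H with H | ⟨H, H'⟩
  · have := h.carry_step x.pt y.pt c.pt
    rcases this with h1 | ⟨h1, h2⟩
    · left; linarith
    · rcases (Int.add_one_le_iff.2 H).lt_or_eq with h3 | h3
      · left; linarith
      · right; exact ⟨by linarith, h2⟩
  · rcases h.carry_add_mono c.pt H' with h1 | ⟨h1, h2⟩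
    · left; linarith
    · right; exact ⟨by linarith, h2⟩

instance : IsOrderedAddMonoid (Cover h) where
  add_le_add_left x y H c := by
    rcases H.lt_or_eq with H | rfl
    · rw [add_comm x, add_comm y]
      exact (add_lt_add_left' H c).le
    · rfl

/-- The projection of the universal cover to the group. -/
noncomputable def proj (h : IsOrientation O) : Cover h →+ A where
  toFun := pt
  map_zero' := rfl
  map_add' _ _ := rfl

/-- The lift of an element of the group to the interval `[0, 1)` of the universal cover. -/
def lift (h : IsOrientation O) (a : A) : Cover h := ⟨0, a⟩

/-- The positive generator of the kernel of the projection. -/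
def one (h : IsOrientation O) : Cover h := ⟨1, 0⟩

@[simp] theorem proj_lift (a : A) : proj h (lift h a) = a := rfl

@[simp] theorem proj_one : proj h (one h) = 0 := rfl

theorem proj_apply (x : Cover h) : proj h x = x.pt := rfl

theorem zsmul_one_eq (n : ℤ) : n • one h = ⟨n, 0⟩ := by
  have : ∀ n : ℕ, (n : ℤ) • one h = ⟨n, 0⟩ := by
    intro n
    induction n with
    | zero => simp; rfl
    | succ n ih =>
      push_cast
      rw [add_zsmul, ih, one_zsmul]
      ext <;> simp [add_int, one, h.carry_zero]
  rcases n.eq_nat_or_neg with ⟨m, rfl | rfl⟩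
  · exact this m
  · rw [neg_zsmul, this]
    ext <;> simp [neg_int, h.carry_zero]

theorem eq_add (x : Cover h) : x = lift h (proj h x) + x.int • one h := by
  rw [zsmul_one_eq]
  ext <;> simp [add_int, h.carry_zero, lift, proj_apply]

theorem one_pos : 0 < one h := by
  rw [lt_iff]
  left
  simp [one]

theorem proj_eq_zero {x : Cover h} : proj h x = 0 ↔ ∃ n : ℤ, x = n • one h := by
  constructor
  · intro H
    refine ⟨x.int, ?_⟩
    rw [zsmul_one_eq]
    ext
    · rfl
    · exact H
  · rintro ⟨n, rfl⟩
    simp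

theorem lift_nonneg (a : A) : 0 ≤ lift h a := by
  rw [← not_lt, lt_iff]
  rintro (H | ⟨-, H⟩)
  · exact lt_irrefl _ H
  · exact h.not_lt_zero _ H

theorem lift_lt_one (a : A) : lift h a < one h := by
  rw [lt_iff]
  left
  simp [lift, one]

theorem eq_lift {x : Cover h} (h0 : 0 ≤ x) (h1 : x < one h) : x = lift h (proj h x) := by
  have : x.int = 0 := by
    rw [← not_lt, lt_iff] at h0
    rw [lt_iff] at h1
    have h2 : ¬ x.int < 0 := fun H => h0 (Or.inl H)
    rcases h1 with h1 | ⟨h1, h3⟩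
    · simp only [one] at h1
      omega
    · exact absurd h3 (h.not_lt_zero _)
  ext
  · exact this
  · rfl

theorem lift_lt_lift {a b : A} : lift h a < lift h b ↔ h.lt a b := by
  rw [lt_iff]
  simp [lift]

theorem lift_injective : Function.Injective (lift h) := fun a b H => by
  simpa [lift] using H

theorem lift_zero : lift h 0 = 0 := rfl

theorem orient_zero_iff {a b : A} : O 0 a b ↔ 0 < lift h a ∧ lift h a < lift h b := by
  rw [← lift_zero, lift_lt_lift, lift_lt_lift, h.iff_lt]
  have := h.not_lt_zero
  tauto

/-- Integer part and fractional part of an element of the universal cover. -/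
theorem exists_int (x : Cover h) : ∃ m : ℤ, 0 ≤ x + m • one h ∧ x + m • one h < one h := by
  refine ⟨-x.int, ?_⟩
  have : x + (-x.int) • one h = lift h (proj h x) := by
    nth_rw 1 [eq_add x]
    simp
  rw [this]
  exact ⟨lift_nonneg _, lift_lt_one _⟩

/-- Each element has exactly one translate in `[0, one)`, where the order is that of `A` with `0`
first. This turns the orientation into positivity in the cover, at the cost of two integers. -/
theorem orient_zero_iff_exists (x y : Cover h) : O 0 (proj h x) (proj h y) ↔
    ∃ m n : ℤ, 0 < x + m • one h ∧ x + m • one h < y + n • one h ∧ y + n • one h < one h := by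
  rw [orient_zero_iff (h := h)]
  constructor
  · rintro ⟨h1, h2⟩
    refine ⟨-x.int, -y.int, ?_⟩
    have e : ∀ x : Cover h, x + (-x.int) • one h = lift h (proj h x) := by
      intro x
      nth_rw 1 [eq_add x]
      simp
    rw [e, e]
    exact ⟨h1, h2, lift_lt_one _⟩
  · rintro ⟨m, n, h1, h2, h3⟩
    have e1 := eq_lift h1.le (h2.trans h3)
    have e2 := eq_lift (h1.trans h2).le h3
    rw [e1] at h1 h2
    rw [e2] at h2
    simpa using And.intro h1 h2

end Cover

/-! ### Dense pairs of ordered groups: extension of partial types -/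

/-- An ordered group `B` with a distinguished element `one` and a dense pure subgroup `H` of
infinite index, such that `B = N B + ℤ one` for every `N`. -/
structure IsDensePair {B : Type*} [AddCommGroup B] [LinearOrder B] (one : B) (H : AddSubgroup B) :
    Prop where
  one_mem : one ∈ H
  resid : ∀ N : ℤ, 0 < N → ∀ b, ∃ c, ∃ k : ℤ, 0 ≤ k ∧ k < N ∧ b = N • c + k • one
  pure : ∀ N : ℤ, 0 < N → ∀ b, N • b ∈ H → b ∈ H
  dense : ∀ N : ℤ, 0 < N → ∀ a b : B, a < b → ∃ h ∈ H, a < N • h ∧ N • h < b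
  infinite : Infinite (B ⧸ H)

/-- All coefficients of `c` are bounded by `C`. -/
def Bounded {κ : Type*} (C : ℤ) (c : κ → ℤ) : Prop := ∀ i, |c i| ≤ C

namespace Bounded

variable {κ : Type*} {C D : ℤ} {c d : κ → ℤ}

theorem mono (h : Bounded C c) (hCD : C ≤ D) : Bounded D c := fun i => (h i).trans hCD

theorem add (h : Bounded C c) (h' : Bounded D d) : Bounded (C + D) (c + d) :=
  fun i => (abs_add_le _ _).trans (add_le_add (h i) (h' i))

theorem neg (h : Bounded C c) : Bounded C (-c) := fun i => by simpa using h i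

theorem sub (h : Bounded C c) (h' : Bounded D d) : Bounded (C + D) (c - d) := by
  rw [sub_eq_add_neg]
  exact h.add h'.neg

theorem smul (h : Bounded C c) {q : ℤ} (hq : |q| ≤ D) : Bounded (D * C) (q • c) := fun i => by
  rw [Pi.smul_apply, smul_eq_mul, abs_mul]
  exact mul_le_mul hq (h i) (abs_nonneg _) ((abs_nonneg _).trans hq)

theorem single [DecidableEq κ] (o : κ) {q : ℤ} (hq : |q| ≤ D) : Bounded D (Pi.single o q) :=
  fun i => by
    rcases eq_or_ne i o with rfl | hi
    · simpa using hq
    · simpa [Pi.single_eq_of_ne hi] using (abs_nonneg _).trans hq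

theorem finite [Finite κ] (C : ℤ) : {c : κ → ℤ | Bounded C c}.Finite := by
  have := Fintype.ofFinite κ
  classical
  refine (Set.finite_Icc (fun _ : κ => -C) (fun _ => C)).subset fun c hc => ?_
  exact ⟨fun i => (abs_le.1 (hc i)).1, fun i => (abs_le.1 (hc i)).2⟩

end Bounded

/-- The tuples `z` and `z'` satisfy the same atomic conditions with coefficients bounded by `C`. -/
structure Eqv {B κ : Type*} [AddCommGroup B] [LinearOrder B] [Fintype κ] (H : AddSubgroup B)
    (C : ℤ) (z z' : κ → B) : Prop where
  pos : ∀ c, Bounded C c →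
    (0 < Fintype.linearCombination ℤ z c ↔ 0 < Fintype.linearCombination ℤ z' c)
  mem : ∀ c, Bounded C c →
    (Fintype.linearCombination ℤ z c ∈ H ↔ Fintype.linearCombination ℤ z' c ∈ H)
  dvd : ∀ c, Bounded C c → ∀ N : ℤ, 0 < N → N ≤ C →
    ((∃ b, Fintype.linearCombination ℤ z c = N • b) ↔
      ∃ b, Fintype.linearCombination ℤ z' c = N • b)

namespace Eqv

variable {B κ : Type*} [AddCommGroup B] [LinearOrder B] [Fintype κ] {H : AddSubgroup B}
  {C D : ℤ} {z z' : κ → B}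

theorem mono (h : Eqv H D z z') (hCD : C ≤ D) : Eqv H C z z' where
  pos c hc := h.pos c (hc.mono hCD)
  mem c hc := h.mem c (hc.mono hCD)
  dvd c hc N h0 hN := h.dvd c (hc.mono hCD) N h0 (hN.trans hCD)

theorem symm (h : Eqv H C z z') : Eqv H C z' z where
  pos c hc := (h.pos c hc).symm
  mem c hc := (h.mem c hc).symm
  dvd c hc N h0 hN := (h.dvd c hc N h0 hN).symm

variable [IsOrderedAddMonoid B]

theorem neg_iff (h : Eqv H C z z') {c : κ → ℤ} (hc : Bounded C c) :
    Fintype.linearCombination ℤ z c < 0 ↔ Fintype.linearCombination ℤ z' c < 0 := by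
  have := h.pos (-c) hc.neg
  simpa only [map_neg, Left.neg_pos_iff] using this

theorem eq_zero_iff (h : Eqv H C z z') {c : κ → ℤ} (hc : Bounded C c) :
    Fintype.linearCombination ℤ z c = 0 ↔ Fintype.linearCombination ℤ z' c = 0 := by
  rw [le_antisymm_iff, le_antisymm_iff, ← not_lt, ← not_lt, ← not_lt, ← not_lt, h.pos c hc,
    h.neg_iff hc]

end Eqv

namespace IsDensePair

variable {B κ : Type*} [AddCommGroup B] [LinearOrder B] [IsOrderedAddMonoid B] [Fintype κ]
  {one : B} {H : AddSubgroup B} {C L : ℤ} {z z' : κ → B}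

theorem mem_smul_iff (hB : IsDensePair one H) {N : ℤ} (hN : 0 < N) (b : B) : N • b ∈ H ↔ b ∈ H :=
  ⟨hB.pure N hN b, fun h => H.zsmul_mem h N⟩

/-- An element with prescribed membership pattern in the cosets of `H`. -/
theorem exists_mem_pattern (hB : IsDensePair one H) (hC : 1 ≤ C) {E : ℤ} (hE : 2 * C * C ≤ E)
    (h : Eqv H E z z') (w : B) : ∃ w' : B, ∀ (d : ℤ) (c : κ → ℤ), |d| ≤ C → Bounded C c →
      (d • w + Fintype.linearCombination ℤ z c ∈ H ↔
        d • w' + Fintype.linearCombination ℤ z' c ∈ H) := by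
  have hCE : C ≤ E := by nlinarith
  -- Either `w` satisfies a relation modulo `H` over `z`, and that one relation decides all others,
  -- or it satisfies none and a generic coset will do.
  by_cases hex : ∃ (d : ℤ) (c : κ → ℤ), 0 < d ∧ d ≤ C ∧ Bounded C c ∧
      d • w + Fintype.linearCombination ℤ z c ∈ H
  · obtain ⟨d0, c0, hd0, hd0C, hc0, hmem⟩ := hex
    obtain ⟨w1, k, -, -, hk⟩ := hB.resid d0 hd0 (-Fintype.linearCombination ℤ z' c0)
    have hmem' : d0 • w1 + Fintype.linearCombination ℤ z' c0 ∈ H := by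
      have : d0 • w1 + Fintype.linearCombination ℤ z' c0 = -(k • one) := by
        rw [← neg_neg (Fintype.linearCombination ℤ z' c0), hk]
        abel
      rw [this]
      exact H.neg_mem (H.zsmul_mem hB.one_mem k)
    refine ⟨w1, fun d c hd hc => ?_⟩
    -- By purity the condition may be multiplied by `d0`; subtracting `d` times the known relation
    -- eliminates `w`, with coefficients at most `2 * C * C`.
    have key : ∀ (w : B) (z : κ → B), d0 • w + Fintype.linearCombination ℤ z c0 ∈ H →
        (d • w + Fintype.linearCombination ℤ z c ∈ H ↔
          Fintype.linearCombination ℤ z (d0 • c - d • c0) ∈ H) := by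
      intro w z hz
      rw [← hB.mem_smul_iff hd0 (d • w + _)]
      have : d0 • (d • w + Fintype.linearCombination ℤ z c) =
          d • (d0 • w + Fintype.linearCombination ℤ z c0) +
            Fintype.linearCombination ℤ z (d0 • c - d • c0) := by
        rw [map_sub, map_smul, map_smul, smul_add, smul_add, smul_comm d d0 w]
        abel
      rw [this, H.add_mem_cancel_left (H.zsmul_mem hz d)]
    rw [key w z hmem, key w1 z' hmem']
    refine h.mem _ (((hc.smul (D := C) ?_).sub (hc0.smul hd)).mono ?_)
    · rwa [abs_of_pos hd0]
    · linarith
  · push Not at hex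
    have := hB.infinite
    -- `B ⧸ H` is torsion-free by purity, so each pair `(d, c)` excludes at most one coset.
    have hfin : (⋃ d ∈ Set.Icc 1 C, ⋃ c ∈ {c : κ → ℤ | Bounded C c},
        {q : B ⧸ H | d • q + (Fintype.linearCombination ℤ z' c : B) = 0}).Finite := by
      refine (Set.finite_Icc _ _).biUnion fun d hd => (Bounded.finite C).biUnion fun c _ => ?_
      refine Set.Subsingleton.finite fun q hq q' hq' => ?_
      induction q using QuotientAddGroup.induction_on with | _ x
      induction q' using QuotientAddGroup.induction_on with | _ y
      have e : d • (x : B ⧸ H) = d • (y : B ⧸ H) := add_right_cancel (hq.trans hq'.symm)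
      rw [QuotientAddGroup.eq]
      rw [← QuotientAddGroup.mk_zsmul, ← QuotientAddGroup.mk_zsmul, QuotientAddGroup.eq,
        ← smul_neg, ← smul_add] at e
      exact hB.pure d (by linarith [hd.1]) _ e
    obtain ⟨q, hq⟩ := hfin.exists_notMem
    induction q using QuotientAddGroup.induction_on with | _ w1
    have h1 : ∀ (d : ℤ) (c : κ → ℤ), 0 < d → d ≤ C → Bounded C c →
        d • w1 + Fintype.linearCombination ℤ z' c ∉ H := by
      intro d c hd hdC hc hmem
      refine hq (Set.mem_biUnion (show d ∈ Set.Icc 1 C from ⟨hd, hdC⟩) (Set.mem_biUnion hc ?_))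
      rw [Set.mem_ofPred_eq, ← QuotientAddGroup.mk_zsmul, ← QuotientAddGroup.mk_add,
        QuotientAddGroup.eq_zero_iff]
      exact hmem
    have key : ∀ (w : B) (z : κ → B), (∀ (d : ℤ) (c : κ → ℤ), 0 < d → d ≤ C → Bounded C c →
        d • w + Fintype.linearCombination ℤ z c ∉ H) → ∀ (d : ℤ) (c : κ → ℤ), d ≠ 0 → |d| ≤ C →
        Bounded C c → d • w + Fintype.linearCombination ℤ z c ∉ H := by
      intro w z hz d c hd hdC hc hmem
      rcases hd.lt_or_gt with hd | hd
      · rw [abs_of_neg hd] at hdC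
        refine hz (-d) (-c) (by linarith) hdC hc.neg ?_
        rw [map_neg, neg_smul, ← neg_add]
        exact H.neg_mem hmem
      · rw [abs_of_pos hd] at hdC
        exact hz d c hd hdC hc hmem
    refine ⟨w1, fun d c hd hc => ?_⟩
    rcases eq_or_ne d 0 with rfl | hd0
    · simpa using h.mem c (hc.mono hCE)
    · exact iff_of_false (key w z hex d c hd0 hd hc) (key w1 z' h1 d c hd0 hd hc)

/-- An element of a prescribed residue class filling a prescribed cut. -/
theorem exists_cut (hB : IsDensePair one H) {D E : ℤ} (hE : 2 * D ≤ E) (h : Eqv H E z z')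
    (hL : 0 < L) (w c0 : B) :
    ∃ g ∈ H, ∀ e, Bounded D e →
      (0 < L • w + Fintype.linearCombination ℤ z e →
        0 < L • (c0 + L • g) + Fintype.linearCombination ℤ z' e) ∧
      (L • w + Fintype.linearCombination ℤ z e < 0 →
        L • (c0 + L • g) + Fintype.linearCombination ℤ z' e < 0) := by
  classical
  have : DenselyOrdered B := ⟨fun a b hab => by
    obtain ⟨x, -, h1, h2⟩ := hB.dense 1 one_pos a b hab
    exact ⟨_, h1, h2⟩⟩
  have := hB.infinite
  have : Nontrivial B := (QuotientAddGroup.mk_surjective (s := H)).nontrivial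
  let T := (Bounded.finite (κ := κ) D).toFinset
  let f := fun e : κ → ℤ => -Fintype.linearCombination ℤ z' e
  let S := (T.filter fun e => 0 < L • w + Fintype.linearCombination ℤ z e).image f
  let U := (T.filter fun e => L • w + Fintype.linearCombination ℤ z e < 0).image f
  have hSU : ∀ s ∈ S, ∀ u ∈ U, s < u := by
    intro s hs u hu
    simp only [S, U, T, Finset.mem_image, Finset.mem_filter, Set.Finite.mem_toFinset,
      Set.mem_ofPred_eq] at hs hu
    obtain ⟨e, ⟨he, he'⟩, rfl⟩ := hs
    obtain ⟨e1, ⟨he1, he1'⟩, rfl⟩ := hu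
    have h1 := (h.pos (e - e1) ((he.sub he1).mono (by linarith))).1 (by
      have := he1'.trans he'
      rw [map_sub, sub_pos]
      exact lt_of_add_lt_add_left this)
    rw [map_sub, sub_pos] at h1
    exact neg_lt_neg h1
  -- Two interpolations give a whole interval `(y, x)` inside the cut. The target `L • (c0 + L • g)`
  -- moves with `g` by `(L * L) • g`, hence density is used for multiples of `L * L`.
  obtain ⟨x, hx1, hx2⟩ := Order.exists_between_finsets S U hSU
  obtain ⟨y, hy1, hy2⟩ := Order.exists_between_finsets S {x} (by simpa using hx1)
  have hyx : y < x := hy2 x (Finset.mem_singleton_self x)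
  obtain ⟨g, hg, h1, h2⟩ := hB.dense (L * L) (mul_pos hL hL) (y - L • c0) (x - L • c0)
    (sub_lt_sub_right hyx _)
  have e1 : L • (c0 + L • g) = (L * L) • g + L • c0 := by
    rw [smul_add, smul_smul, add_comm]
  rw [sub_lt_iff_lt_add, ← e1] at h1
  rw [lt_sub_iff_add_lt, ← e1] at h2
  refine ⟨g, hg, fun e he => ⟨fun hpos => ?_, fun hneg => ?_⟩⟩
  · have : f e < y := hy1 _ (Finset.mem_image_of_mem _ (by simp [T, he, hpos]))
    exact neg_lt_iff_pos_add.1 (this.trans h1)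
  · have : x < f e := hx2 _ (Finset.mem_image_of_mem _ (by simp [T, he, hneg]))
    exact lt_neg_iff_add_neg.1 (h2.trans this)

/-- Signs of multiples of `w` plus a combination are determined by those with coefficient `L`. -/
theorem pos_iff_of_cut (hL : 0 < L) (hdvd : ∀ d : ℤ, 0 < d → d ≤ C → d ∣ L) {w w' : B}
    (hz : ∀ c, Bounded C c →
      (0 < Fintype.linearCombination ℤ z c ↔ 0 < Fintype.linearCombination ℤ z' c))
    (hp : ∀ e, Bounded (L * C) e → (0 < L • w + Fintype.linearCombination ℤ z e ↔
      0 < L • w' + Fintype.linearCombination ℤ z' e))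
    (hn : ∀ e, Bounded (L * C) e → (L • w + Fintype.linearCombination ℤ z e < 0 ↔
      L • w' + Fintype.linearCombination ℤ z' e < 0))
    {d : ℤ} {c : κ → ℤ} (hd : |d| ≤ C) (hc : Bounded C c) :
    0 < d • w + Fintype.linearCombination ℤ z c ↔
      0 < d • w' + Fintype.linearCombination ℤ z' c := by
  have hq : ∀ d q : ℤ, 0 < d → L = d * q → 0 < q ∧ |q| ≤ L := by
    intro d q hd h
    have : 0 < q := by
      by_contra hq
      nlinarith
    refine ⟨this, ?_⟩
    rw [abs_of_pos this]
    nlinarith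
  -- Multiplying by `L / |d| > 0` preserves the sign and makes the coefficient of `w` equal to `±L`.
  rcases lt_trichotomy d 0 with h0 | rfl | h0
  · rw [abs_of_neg h0] at hd
    obtain ⟨q, hdq⟩ := hdvd (-d) (by linarith) hd
    obtain ⟨hq0, hqL⟩ := hq _ _ (by linarith) hdq
    have key : ∀ (w : B) (z : κ → B), 0 < d • w + Fintype.linearCombination ℤ z c ↔
        L • w + Fintype.linearCombination ℤ z (-(q • c)) < 0 := by
      intro w z
      rw [← smul_pos_iff_of_pos_left hq0 (b := d • w + _), ← neg_neg_iff_pos, hdq]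
      have : -(q • (d • w + Fintype.linearCombination ℤ z c)) =
          (-d * q) • w + Fintype.linearCombination ℤ z (-(q • c)) := by
        rw [map_neg, map_smul, smul_add, neg_add, smul_smul, ← neg_smul, neg_mul, mul_comm q d]
      rw [this]
    rw [key, key]
    exact hn _ (hc.smul hqL).neg
  · simpa using hz c hc
  · rw [abs_of_pos h0] at hd
    obtain ⟨q, hdq⟩ := hdvd d h0 hd
    obtain ⟨hq0, hqL⟩ := hq _ _ h0 hdq
    have key : ∀ (w : B) (z : κ → B), 0 < d • w + Fintype.linearCombination ℤ z c ↔
        0 < L • w + Fintype.linearCombination ℤ z (q • c) := by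
      intro w z
      rw [← smul_pos_iff_of_pos_left hq0 (b := d • w + _), hdq, map_smul, smul_add, smul_smul,
        mul_comm q d]
    rw [key, key]
    exact hp _ (hc.smul hqL)

/-- Extension of partial types: if `z` and `z'` agree on sufficiently many atomic conditions, then
every `w` has a counterpart `w'`. -/
theorem exists_extension (hB : IsDensePair one H) (κ : Type*) [Fintype κ] (o : κ) {C : ℤ}
    (hC : 1 ≤ C) : ∃ E : ℤ, ∀ z z' : κ → B, z o = one → z' o = one → Eqv H E z z' → ∀ w : B,
      ∃ w' : B, ∀ (d : ℤ) (c : κ → ℤ), |d| ≤ C → Bounded C c →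
        (0 < d • w + Fintype.linearCombination ℤ z c ↔
          0 < d • w' + Fintype.linearCombination ℤ z' c) ∧
        (d • w + Fintype.linearCombination ℤ z c ∈ H ↔
          d • w' + Fintype.linearCombination ℤ z' c ∈ H) ∧
        ∀ N : ℤ, 0 < N → N ≤ C →
          ((∃ b, d • w + Fintype.linearCombination ℤ z c = N • b) ↔
            ∃ b, d • w' + Fintype.linearCombination ℤ z' c = N • b) := by
  classical
  obtain ⟨L, hL1, hdvd⟩ : ∃ L : ℤ, 1 ≤ L ∧ ∀ d : ℤ, 0 < d → d ≤ C → d ∣ L := by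
    refine ⟨(C.toNat.factorial : ℕ), by exact_mod_cast Nat.factorial_pos _, fun d hd hdC => ?_⟩
    lift d to ℕ using hd.le
    exact_mod_cast Nat.dvd_factorial (by exact_mod_cast hd) (by omega)
  have hL : 0 < L := by linarith
  have hCC : C ≤ C * C := by nlinarith
  have hCL : C * C ≤ L * (C * C) := by nlinarith
  have hLC : L * C ≤ L * (C * C) := by nlinarith
  have hLL : L ≤ L * C := by nlinarith
  refine ⟨4 * (L * (C * C)), fun z z' hz hz' h w => ?_⟩
  have hE : C ≤ 4 * (L * (C * C)) := by linarith
  -- Generic case: no bounded combination of `z` equals `-L • w`, so the strict inequalities of a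
  -- cut decide all signs.
  by_cases hw : ∀ e, Bounded (L * C) e → L • w + Fintype.linearCombination ℤ z e ≠ 0
  · obtain ⟨w1, hw1⟩ := hB.exists_mem_pattern hC (by nlinarith) h w
    obtain ⟨x, k, hk0, hkL, hk⟩ := hB.resid L hL w
    obtain ⟨x1, k1, -, -, hk1⟩ := hB.resid L hL w1
    obtain ⟨g, hg, hcut⟩ := hB.exists_cut (D := L * C) (by linarith) h hL w
      (w1 + (k - k1) • one)
    -- Starting from `w1`, which has the right pattern for `H`, the multiple of `one` corrects the
    -- residue modulo `L` to `k` and `L • g` moves the point into the cut. Both corrections lie in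
    -- `H`, so the pattern survives.
    have hr : w1 + (k - k1) • one + L • g = L • (x1 + g) + k • one := by
      rw [hk1, sub_smul, smul_add]
      abel
    refine ⟨w1 + (k - k1) • one + L • g, fun d c hd hc => ⟨?_, ?_, fun N hN hNC => ?_⟩⟩
    · refine pos_iff_of_cut hL hdvd (fun c hc => h.pos c (hc.mono hE)) (fun e he => ?_)
        (fun e he => ?_) hd hc
      · refine ⟨(hcut e he).1, fun h' => ?_⟩
        by_contra hc
        exact lt_asymm h' ((hcut e he).2 (lt_of_le_of_ne (not_lt.1 hc) (hw e he)))
      · refine ⟨(hcut e he).2, fun h' => ?_⟩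
        by_contra hc
        exact lt_asymm h' ((hcut e he).1 (lt_of_le_of_ne (not_lt.1 hc) (hw e he).symm))
    · rw [hw1 d c hd hc]
      have : d • (w1 + (k - k1) • one + L • g) + Fintype.linearCombination ℤ z' c =
          d • ((k - k1) • one + L • g) + (d • w1 + Fintype.linearCombination ℤ z' c) := by
        rw [add_assoc w1, smul_add d w1]
        abel
      rw [this]
      refine (H.add_mem_cancel_left ?_).symm
      exact H.zsmul_mem (H.add_mem (H.zsmul_mem hB.one_mem _) (H.zsmul_mem hg _)) _
    · rw [hr, hk]
      obtain ⟨q, hq⟩ := hdvd N hN hNC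
      -- Since `N ∣ L`, only the residue `k` of the new element matters; it is absorbed into the
      -- coefficient of `z o = one`.
      have key : ∀ (x : B) (z : κ → B), z o = one →
          ((∃ b, d • (L • x + k • one) + Fintype.linearCombination ℤ z c = N • b) ↔
            ∃ b, Fintype.linearCombination ℤ z (c + Pi.single o (d * k)) = N • b) := by
        intro x z hz
        have : d • (L • x + k • one) + Fintype.linearCombination ℤ z c = N • ((d * q) • x) +
            Fintype.linearCombination ℤ z (c + Pi.single o (d * k)) := by
          rw [map_add, Fintype.linearCombination_apply_single, hz, hq, smul_add, smul_smul,
            smul_smul, smul_smul]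
          rw [show d * (N * q) = N * (d * q) by ring]
          abel
        rw [this]
        constructor
        · rintro ⟨b, hb⟩
          exact ⟨b - (d * q) • x, by rw [smul_sub, ← hb]; abel⟩
        · rintro ⟨b, hb⟩
          exact ⟨b + (d * q) • x, by rw [smul_add, ← hb]; abel⟩
      rw [key x z hz, key _ z' hz']
      refine h.dvd _ ((hc.add (Bounded.single o (D := C * L) ?_)).mono (by nlinarith)) N hN
        (hNC.trans hE)
      rw [abs_mul, abs_of_nonneg hk0]
      exact mul_le_mul hd hkL.le hk0 (by linarith)
  · push Not at hw
    obtain ⟨e, he, hwe⟩ := hw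
    -- Here `L • w` is a combination of `z`. Divisibility by `L` transfers and provides `w'`;
    -- multiplying by `L` then turns every condition on `w` into one on `z` alone.
    obtain ⟨w', hw'⟩ := (h.dvd (-e) (he.neg.mono (by linarith)) L hL (by linarith)).1
      ⟨w, by rw [map_neg]; exact (eq_neg_of_add_eq_zero_left hwe).symm⟩
    replace hwe : L • w = -Fintype.linearCombination ℤ z e := eq_neg_of_add_eq_zero_left hwe
    replace hw' : L • w' = -Fintype.linearCombination ℤ z' e := by rw [← hw', map_neg]
    have hsub : ∀ (w : B) (z : κ → B), L • w = -Fintype.linearCombination ℤ z e →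
        ∀ e', L • w + Fintype.linearCombination ℤ z e' =
          Fintype.linearCombination ℤ z (e' - e) := by
      intro w z hw e'
      rw [hw, map_sub]
      abel
    have hmul : ∀ (w : B) (z : κ → B), L • w = -Fintype.linearCombination ℤ z e →
        ∀ (d : ℤ) (c : κ → ℤ), L • (d • w + Fintype.linearCombination ℤ z c) =
          Fintype.linearCombination ℤ z (L • c - d • e) := by
      intro w z hw d c
      rw [smul_add, smul_comm, hw, map_sub, map_smul, map_smul, smul_neg]
      abel
    have hbd : ∀ (d : ℤ) (c : κ → ℤ), |d| ≤ C → Bounded C c →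
        Bounded (4 * (L * (C * C))) (L • c - d • e) := by
      intro d c hd hc
      refine ((hc.smul (abs_of_pos hL).le).sub (he.smul hd)).mono ?_
      nlinarith
    refine ⟨w', fun d c hd hc => ⟨?_, ?_, fun N hN hNC => ?_⟩⟩
    · refine pos_iff_of_cut hL hdvd (fun c hc => h.pos c (hc.mono hE)) (fun e' he' => ?_)
        (fun e' he' => ?_) hd hc
      · rw [hsub w z hwe, hsub w' z' hw']
        exact h.pos _ ((he'.sub he).mono (by linarith))
      · rw [hsub w z hwe, hsub w' z' hw']
        exact h.neg_iff ((he'.sub he).mono (by linarith))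
    · rw [← hB.mem_smul_iff hL, ← hB.mem_smul_iff hL (d • w' + _), hmul w z hwe, hmul w' z' hw']
      exact h.mem _ (hbd d c hd hc)
    · have key : ∀ (w : B) (z : κ → B), L • w = -Fintype.linearCombination ℤ z e →
          ((∃ b, d • w + Fintype.linearCombination ℤ z c = N • b) ↔
            ∃ b, Fintype.linearCombination ℤ z (L • c - d • e) = (L * N) • b) := by
        intro w z hw
        refine exists_congr fun b => ?_
        rw [← hmul w z hw, ← smul_smul]
        exact (smul_right_injective B hL.ne').eq_iff.symm
      rw [key w z hwe, key w' z' hw']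
      refine h.dvd _ (hbd d c hd hc) _ (mul_pos hL hN) ?_
      have : L * N ≤ L * C := mul_le_mul_of_nonneg_left hNC hL.le
      linarith

end IsDensePair

/-! ### The universal cover of a dense pair of oriented groups -/

/-- Regular density, with all elements restricted to a subgroup `G`. -/
def RegDense {A : Type*} [AddCommGroup A] (O : A → A → A → Prop) (G : AddSubgroup A) : Prop :=
  ∀ p : ℕ, p.Prime → ∀ a ∈ G, ∀ b ∈ G, O 0 a b → ∃ c ∈ G, O a (p • c) b ∧
    ∀ i : ℕ, 1 ≤ i → i ≤ p - 1 → O 0 (i • c) ((i + 1) • c)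

/-- A dense pair of divisible torsion-free regularly dense oriented groups. -/
structure IsOrientedPair {A : Type*} [AddCommGroup A] (O : A → A → A → Prop) (G : AddSubgroup A) :
    Prop where
  orientation : IsOrientation O
  div : ∀ p : ℕ, p.Prime → ∀ a : A, ∃ b, p • b = a
  torsionFree : ∀ p : ℕ, p.Prime → ∀ a : A, p • a = 0 → a = 0
  regDense : RegDense O ⊤
  div_sub : ∀ p : ℕ, p.Prime → ∀ a ∈ G, ∃ b ∈ G, p • b = a
  regDense_sub : RegDense O G
  dense : ∀ a b x, O a x b → ∃ g ∈ G, O a g b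
  infinite : Infinite (A ⧸ G)

namespace Cover

variable {A : Type*} [AddCommGroup A] {O : A → A → A → Prop} {h : IsOrientation O}

theorem lift_add {x c : A} (H : O 0 x (x + c)) : lift h x + lift h c = lift h (x + c) := by
  let := h.linearOrder
  have h1 : h.lt x (x + c) := Or.inr H
  have h2 : ¬ h.lt (x + c) x := fun h2 => lt_asymm (α := A) h1 h2
  ext
  · simp [add_int, lift, IsOrientation.carry, h2]
  · rfl

/-- The second clause of regular density ensures that the successive multiples of `c` never wrap
around, so no carry occurs. -/
theorem lift_nsmul {p : ℕ} (hp : 1 ≤ p) {c : A}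
    (H : ∀ i : ℕ, 1 ≤ i → i ≤ p - 1 → O 0 (i • c) ((i + 1) • c)) :
    p • lift h c = lift h (p • c) := by
  have : ∀ i : ℕ, 1 ≤ i → i ≤ p → i • lift h c = lift h (i • c) := by
    intro i hi
    induction i, hi using Nat.le_induction with
    | base => intro; simp
    | succ i hi ih =>
      intro hip
      rw [succ_nsmul, ih (by omega), succ_nsmul c]
      have := H i hi (by omega)
      rw [succ_nsmul c] at this
      exact lift_add this
  exact this p hp le_rfl

theorem exists_mul_between {G : AddSubgroup A} (hG : RegDense O G) {p : ℕ} (hp : p.Prime)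
    {x y : Cover h} (hx : proj h x ∈ G) (hy : proj h y ∈ G) (h0 : 0 < x) (hxy : x < y)
    (h1 : y < one h) : ∃ c, proj h c ∈ G ∧ x < p • c ∧ p • c < y := by
  have ex := eq_lift h0.le (hxy.trans h1)
  have ey := eq_lift (h0.trans hxy).le h1
  generalize proj h x = a at *
  generalize proj h y = b at *
  subst ex ey
  obtain ⟨c, hc, hO, hi⟩ := hG p hp a hx b hy (orient_zero_iff.2 ⟨h0, hxy⟩)
  refine ⟨lift h c, hc, ?_⟩
  rw [lift_nsmul hp.one_lt.le hi, lift_lt_lift, lift_lt_lift]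
  let := h.linearOrder
  rw [lift_lt_lift] at hxy
  rw [h.iff_lt] at hO
  -- The other two rotations would put `b` below `a`.
  rcases hO with hO | ⟨h2, h3⟩ | ⟨h2, h3⟩
  · exact hO
  · exact absurd hxy (lt_asymm (α := A) h3)
  · exact absurd hxy (lt_asymm (α := A) h2)

end Cover

/-! ### Density of the multiples of the lifted subgroup. -/

namespace IsOrientedPair

open Cover

variable {A : Type*} [AddCommGroup A] {O : A → A → A → Prop} {G : AddSubgroup A}

theorem div_of_pos (hA : IsOrientedPair O G) (N : ℕ) (hN : 0 < N) (a : A) : ∃ b, N • b = a := by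
  induction N using Nat.recOnMul generalizing a with
  | zero => omega
  | one => exact ⟨a, one_nsmul a⟩
  | prime p hp => exact hA.div p hp a
  | mul m n hm hn =>
    obtain ⟨b, rfl⟩ := hm (Nat.pos_of_mul_pos_right hN) a
    obtain ⟨c, rfl⟩ := hn (Nat.pos_of_mul_pos_left hN) b
    exact ⟨c, mul_nsmul' c m n⟩

theorem div_sub_of_pos (hA : IsOrientedPair O G) (N : ℕ) (hN : 0 < N) (a : A) (ha : a ∈ G) :
    ∃ b ∈ G, N • b = a := by
  induction N using Nat.recOnMul generalizing a with
  | zero => omega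
  | one => exact ⟨a, ha, one_nsmul a⟩
  | prime p hp => exact hA.div_sub p hp a ha
  | mul m n hm hn =>
    obtain ⟨b, hb, rfl⟩ := hm (Nat.pos_of_mul_pos_right hN) a ha
    obtain ⟨c, hc, rfl⟩ := hn (Nat.pos_of_mul_pos_left hN) b hb
    exact ⟨c, hc, mul_nsmul' c m n⟩

theorem torsionFree_of_pos (hA : IsOrientedPair O G) (N : ℕ) (hN : 0 < N) (a : A)
    (ha : N • a = 0) : a = 0 := by
  induction N using Nat.recOnMul generalizing a with
  | zero => omega
  | one => simpa using ha
  | prime p hp => exact hA.torsionFree p hp a ha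
  | mul m n hm hn =>
    rw [mul_nsmul'] at ha
    exact hn (Nat.pos_of_mul_pos_left hN) a (hm (Nat.pos_of_mul_pos_right hN) _ ha)

variable {h : IsOrientation O}

/-- A least positive `e` would satisfy `e < one` and `2 • e ≤ one`. If `2 • e < one`, regular
density at `2` puts some `2 • c` strictly between `e` and `2 • e`, and `2 • c - e` is a smaller
positive element. If `2 • e = one`, then `e` projects to a `2`-torsion element, so `e = 0`. -/
theorem exists_small (hA : IsOrientedPair O G) {e : Cover h} (he : 0 < e) :
    ∃ x, 0 < x ∧ x < e := by
  by_contra! hc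
  have := hA.infinite
  have : Nontrivial A := (QuotientAddGroup.mk_surjective (s := G)).nontrivial
  have he1 : e ≤ one h := hc _ one_pos
  have he2 : e ≠ one h := by
    rintro rfl
    obtain ⟨a, ha⟩ := exists_ne (0 : A)
    have h0 : 0 < lift h a := by
      refine lt_of_le_of_ne (lift_nonneg a) fun h0 => ha ?_
      rw [← lift_zero] at h0
      exact (lift_injective h0).symm
    exact absurd (hc _ h0) (not_le.2 (lift_lt_one a))
  have he3 : e < one h := lt_of_le_of_ne he1 he2
  have he4 : 2 • e ≤ one h := by
    have := hc (one h - e) (sub_pos.2 he3)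
    rw [two_nsmul]
    exact le_sub_iff_add_le.1 this
  rcases he4.lt_or_eq with h4 | h4
  · obtain ⟨c, -, h5, h6⟩ := exists_mul_between hA.regDense Nat.prime_two
      (x := e) (y := 2 • e) (AddSubgroup.mem_top _) (AddSubgroup.mem_top _) he
      (by rw [two_nsmul]; exact lt_add_of_pos_left e he) h4
    have := hc _ (sub_pos.2 h5)
    rw [le_sub_iff_add_le, ← two_nsmul] at this
    exact absurd h6 (not_lt.2 this)
  · have h5 : proj h e = 0 := hA.torsionFree 2 Nat.prime_two _ (by
      rw [← map_nsmul, h4, proj_one])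
    have h6 := eq_lift he.le he3
    rw [h5, lift_zero] at h6
    exact he.ne' h6

theorem exists_between_cover (hA : IsOrientedPair O G) {x y : Cover h} (hxy : x < y) :
    ∃ z, x < z ∧ z < y := by
  obtain ⟨e, h0, h1⟩ := hA.exists_small (sub_pos.2 hxy)
  exact ⟨x + e, lt_add_of_pos_right x h0, lt_sub_iff_add_lt'.1 h1⟩

theorem exists_sub_between (hA : IsOrientedPair O G) {x y : Cover h} (hxy : x < y) :
    ∃ g, proj h g ∈ G ∧ x < g ∧ g < y := by
  -- The interval is shortened below length `one`, so that it projects to an orientation interval,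
  -- nonempty because of `z`.
  obtain ⟨y1, hy0, hy1⟩ := hA.exists_between_cover
    (lt_min hxy (lt_add_of_pos_right x (one_pos (h := h))))
  obtain ⟨z, hz0, hz1⟩ := hA.exists_between_cover hy0
  have hy2 : y1 - x < one h := sub_lt_iff_lt_add'.2 (hy1.trans_le (min_le_right _ _))
  have hO : O 0 (proj h (z - x)) (proj h (y1 - x)) := (orient_zero_iff_exists _ _).2
    ⟨0, 0, by simpa using hz0, by simpa using hz1, by simpa using hy2⟩
  rw [map_sub, map_sub, ← h.base] at hO
  obtain ⟨g, hg, hO'⟩ := hA.dense _ _ _ hO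
  rw [h.base, ← proj_lift (h := h) g, ← map_sub, ← map_sub, orient_zero_iff_exists (h := h)] at hO'
  obtain ⟨m, n, h1, h2, h3⟩ := hO'
  have hn : y1 - x + n • one h = y1 - x := by
    rw [eq_lift (h1.trans h2).le h3, eq_lift (sub_pos.2 hy0).le hy2]
    simp
  rw [hn] at h2
  refine ⟨lift h g + m • one h, by simpa using hg, ?_, ?_⟩
  · have : 0 < lift h g + m • one h - x := by convert h1 using 1; abel
    exact sub_pos.1 this
  · have : lift h g + m • one h - x < y1 - x := by convert h2 using 1; abel
    exact ((sub_lt_sub_iff_right x).1 this).trans (hy1.trans_le (min_le_left _ _))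

theorem exists_prime_between_of_le (hA : IsOrientedPair O G) {p : ℕ} (hp : p.Prime) (m : ℕ)
    {x y : Cover h} (h0 : 0 ≤ x) (hxy : x < y) (hy : y ≤ m • one h) :
    ∃ g, proj h g ∈ G ∧ x < p • g ∧ p • g < y := by
  have base : ∀ {x y : Cover h}, 0 ≤ x → x < y → y ≤ one h →
      ∃ g, proj h g ∈ G ∧ x < p • g ∧ p • g < y := by
    -- Regular density of `G` needs endpoints in `G`, strictly between `0` and `one`; hence the
    -- interval is first shrunk to `(g1, g2)`.
    intro x y h0 hxy hy
    obtain ⟨g1, hg1, h1, h2⟩ := hA.exists_sub_between hxy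
    obtain ⟨g2, hg2, h3, h4⟩ := hA.exists_sub_between h2
    obtain ⟨g, hg, h5, h6⟩ := exists_mul_between hA.regDense_sub hp hg1 hg2
      (h0.trans_lt h1) h3 (h4.trans_le hy)
    exact ⟨g, hg, h1.trans h5, h6.trans h4⟩
  induction m generalizing x y with
  | zero =>
    rw [zero_nsmul] at hy
    exact absurd hxy (not_lt.2 (hy.trans h0))
  | succ m ih =>
    rcases m.eq_zero_or_pos with rfl | hm
    · exact base h0 hxy (by simpa using hy)
    obtain ⟨x', hx1, hx2⟩ := hA.exists_between_cover hxy
    obtain ⟨y', hy1, hy2⟩ := hA.exists_between_cover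
      (lt_min hx2 (lt_add_of_pos_right x' (one_pos (h := h))))
    have hyy : y' < y := hy2.trans_le (min_le_left _ _)
    have hm1 : 0 < m • one h := nsmul_pos Cover.one_pos hm.ne'
    -- A multiple `p • t` in this window translates `(x', y')` into `[0, one]`, where the base case
    -- applies.
    have hlt : max (y' - one h) 0 < min x' (m • one h) := by
      refine max_lt (lt_min ?_ ?_) (lt_min (h0.trans_lt hx1) hm1)
      · exact sub_lt_iff_lt_add.2 (hy2.trans_le (min_le_right _ _))
      · rw [sub_lt_iff_lt_add, ← succ_nsmul]
        exact hyy.trans_le hy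
    obtain ⟨t, ht, h1, h2⟩ := ih (le_max_right _ _) hlt (min_le_right _ _)
    obtain ⟨s, hs, h3, h4⟩ := base (x := x' - p • t) (y := y' - p • t)
      (sub_nonneg.2 (h2.trans_le (min_le_left _ _)).le) (sub_lt_sub_right hy1 _)
      (sub_le_comm.1 ((le_max_left _ _).trans h1.le))
    refine ⟨s + t, by rw [map_add]; exact G.add_mem hs ht, ?_, ?_⟩
    · rw [nsmul_add]
      exact hx1.trans (sub_lt_iff_lt_add.1 h3)
    · rw [nsmul_add]
      exact (lt_sub_iff_add_lt.1 h4).trans hyy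

theorem exists_prime_between (hA : IsOrientedPair O G) {p : ℕ} (hp : p.Prime)
    {x y : Cover h} (hxy : x < y) : ∃ g, proj h g ∈ G ∧ x < p • g ∧ p • g < y := by
  obtain ⟨j, hj, -⟩ := exists_int x
  -- Translation by `p * |j|` copies of `one` makes the left end nonnegative, and is undone by
  -- subtracting `|j| • one` from `g`, which does not change its projection.
  have hpj : j ≤ (p : ℤ) * |j| := by
    have : (1 : ℤ) ≤ p := by exact_mod_cast hp.one_lt.le
    have := le_abs_self j
    have := abs_nonneg j
    nlinarith
  obtain ⟨k, -, hk⟩ := exists_int (y + ((p : ℤ) * |j|) • one h)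
  obtain ⟨g, hg, h1, h2⟩ := hA.exists_prime_between_of_le hp (1 - k).toNat
    (x := x + ((p : ℤ) * |j|) • one h) (y := y + ((p : ℤ) * |j|) • one h)
    (hj.trans (by gcongr; exact one_pos.le)) (by gcongr) (by
      have h1 : y + ((p : ℤ) * |j|) • one h ≤ (1 - k) • one h := by
        rw [sub_smul, one_smul]
        exact le_sub_iff_add_le.2 hk.le
      refine h1.trans ?_
      rw [← natCast_zsmul]
      gcongr
      · exact one_pos.le
      · exact Int.self_le_toNat _)
  refine ⟨g - |j| • one h, by simpa using hg, ?_, ?_⟩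
  · rw [nsmul_sub, lt_sub_iff_add_lt, ← natCast_zsmul, smul_smul]
    exact h1
  · rw [nsmul_sub, sub_lt_iff_lt_add, ← natCast_zsmul (_ • _), smul_smul]
    exact h2

theorem exists_nsmul_between (hA : IsOrientedPair O G) (N : ℕ) (hN : 0 < N)
    {x y : Cover h} (hxy : x < y) : ∃ g, proj h g ∈ G ∧ x < N • g ∧ N • g < y := by
  induction N using Nat.recOnMul generalizing x y with
  | zero => omega
  | one => simpa using hA.exists_sub_between hxy
  | prime p hp => exact hA.exists_prime_between hp hxy
  | mul m n hm hn =>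
    have hm0 := Nat.pos_of_mul_pos_right hN
    -- With `m • g` in `(x, y)` and `0 < m • e < y - m • g`, any `n • f` in `(g, g + e)` satisfies
    -- `x < m • n • f < y`.
    obtain ⟨g, hg, h1, h2⟩ := hm hm0 hxy
    obtain ⟨e, he, h3, h4⟩ := hm hm0 (sub_pos.2 h2)
    obtain ⟨f, hf, h5, h6⟩ := hn (Nat.pos_of_mul_pos_left hN)
      (lt_add_of_pos_right g ((nsmul_pos_iff hm0.ne').1 h3))
    refine ⟨f, hf, ?_, ?_⟩ <;> rw [mul_nsmul']
    · exact h1.trans (nsmul_lt_nsmul_right hm0.ne' h5)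
    · refine (nsmul_lt_nsmul_right hm0.ne' h6).trans ?_
      rw [nsmul_add]
      exact lt_sub_iff_add_lt'.1 h4

theorem isDensePair (hA : IsOrientedPair O G) :
    IsDensePair (one h) (G.comap (proj h)) where
  one_mem := by simp
  resid N hN b := by
    lift N to ℕ using hN.le
    obtain ⟨a, ha⟩ := hA.div_of_pos N (by omega) (proj h b)
    -- Dividing in `A` solves the problem up to a multiple `j` of `one`; the remainder of `j` modulo
    -- `N` is the residue.
    obtain ⟨j, hj⟩ := proj_eq_zero.1 (show proj h (b - (N : ℤ) • lift h a) = 0 by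
      simp [ha])
    refine ⟨lift h a + (j / N) • one h, j % N, Int.emod_nonneg _ hN.ne', Int.emod_lt_of_pos _ hN, ?_⟩
    rw [smul_add, add_assoc, smul_smul, ← add_smul, Int.mul_ediv_add_emod, ← hj]
    abel
  pure N hN b hb := by
    lift N to ℕ using hN.le
    rw [AddSubgroup.mem_comap, natCast_zsmul, map_nsmul] at hb
    obtain ⟨g, hg, hgb⟩ := hA.div_sub_of_pos N (by omega) _ hb
    have := hA.torsionFree_of_pos N (by omega) (proj h b - g) (by rw [nsmul_sub, hgb, sub_self])
    rw [AddSubgroup.mem_comap, sub_eq_zero.1 this]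
    exact hg
  dense N hN a b hab := by
    lift N to ℕ using hN.le
    obtain ⟨g, hg, h1⟩ := hA.exists_nsmul_between N (by omega) hab
    exact ⟨g, hg, by simpa using h1⟩
  infinite := by
    have := hA.infinite
    refine Infinite.of_surjective (QuotientAddGroup.map (G.comap (proj h)) G (proj h) le_rfl) ?_
    intro q
    induction q using QuotientAddGroup.induction_on with | _ a
    exact ⟨(lift h a : Cover h), rfl⟩

end IsOrientedPair

/-! ### Formulas only depend on finitely many atomic conditions -/

/-- The symbols of the language of pairs are interpreted by the group operations of `M`, the
orientation `O` and the subgroup `G`. -/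
structure Interprets {M : Type*} [LOp.Structure M] [AddCommGroup M] (O : M → M → M → Prop)
    (G : AddSubgroup M) : Prop where
  zero : ∀ v : Fin 0 → M, Structure.funMap (L := LOp) (Sum.inl GroupFunc.zero) v = 0
  neg : ∀ v : Fin 1 → M, Structure.funMap (L := LOp) (Sum.inl GroupFunc.neg) v = -v 0
  add : ∀ v : Fin 2 → M, Structure.funMap (L := LOp) (Sum.inl GroupFunc.add) v = v 0 + v 1
  orient : ∀ v : Fin 3 → M, Structure.RelMap (L := LOp) (Sum.inl OrientRel.orient) v ↔
    O (v 0) (v 1) (v 2)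
  pred : ∀ v : Fin 1 → M, Structure.RelMap (L := LOp) (Sum.inr PredRel.V) v ↔ v 0 ∈ G

section Formulas

variable {M : Type*} [AddCommGroup M] {O : M → M → M → Prop} {h : IsOrientation O}

/-- The lift of a tuple to the universal cover, extended by the element `1`. -/
def liftTuple (h : IsOrientation O) {β : Type*} (v : β → M) : Option β → Cover h
  | none => Cover.one h
  | some i => Cover.lift h (v i)

/-! ### Bounds on integer parts of combinations. -/

namespace liftTuple

variable {β : Type*} [Fintype β]

theorem abs_le (v : β → M) (o : Option β) : |liftTuple h v o| ≤ Cover.one h := by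
  cases o with
  | none => exact (abs_of_pos Cover.one_pos).le
  | some i =>
    rw [liftTuple, abs_of_nonneg (Cover.lift_nonneg _)]
    exact (Cover.lift_lt_one _).le

theorem abs_linearCombination_le (v : β → M) (c : Option β → ℤ) :
    |Fintype.linearCombination ℤ (liftTuple h v) c| ≤ (∑ o, |c o|) • Cover.one h := by
  rw [Fintype.linearCombination_apply, Finset.sum_smul]
  refine (Finset.abs_sum_le_sum_abs _ _).trans (Finset.sum_le_sum fun o _ => ?_)
  rw [abs_zsmul]
  exact zsmul_le_zsmul_right (abs_nonneg _) (abs_le v o)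

/-- Lifted entries lie in `[0, one)`, so a combination is at most `∑ |c o|` copies of `one` in
absolute value. This bounds the integers arising when equality and orientation are read in the
cover. -/
theorem bound_int (v : β → M) (c : Option β → ℤ) {m : ℤ}
    (h0 : 0 ≤ Fintype.linearCombination ℤ (liftTuple h v) c + m • Cover.one h)
    (h1 : Fintype.linearCombination ℤ (liftTuple h v) c + m • Cover.one h < Cover.one h) :
    |m| ≤ ∑ o, |c o| := by
  have hK := _root_.abs_le.1 (abs_linearCombination_le (h := h) v c)
  generalize (∑ o, |c o|) = K at *
  generalize Fintype.linearCombination ℤ (liftTuple h v) c = x at *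
  have e1 : m • Cover.one h < (K + 1) • Cover.one h := by
    rw [add_smul, one_smul]
    calc m • Cover.one h < Cover.one h - x := lt_sub_iff_add_lt'.2 h1
      _ ≤ Cover.one h + K • Cover.one h := by
        rw [sub_eq_add_neg]
        gcongr
        exact neg_le.1 hK.1
      _ = _ := add_comm _ _
  have e2 : (-K) • Cover.one h ≤ m • Cover.one h := by
    rw [neg_smul]
    exact (neg_le_neg hK.2).trans (neg_le_iff_add_nonneg'.2 h0)
  have e3 := (zsmul_lt_zsmul_iff_left Cover.one_pos).1 e1
  have e4 := (zsmul_le_zsmul_iff_left Cover.one_pos).1 e2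
  exact _root_.abs_le.2 ⟨e4, by omega⟩

open Classical in
theorem linearCombination_add_int (v : β → M) (c : Option β → ℤ) (m : ℤ) :
    Fintype.linearCombination ℤ (liftTuple h v) (c + Pi.single none m) =
      Fintype.linearCombination ℤ (liftTuple h v) c + m • Cover.one h := by
  rw [map_add, Fintype.linearCombination_apply_single, liftTuple]

theorem bounded_sum (c : Option β → ℤ) : Bounded (∑ o, |c o|) c := fun o =>
  Finset.single_le_sum (f := fun o => |c o|) (fun _ _ => abs_nonneg _) (Finset.mem_univ o)

theorem linearCombination_snoc {α : Type*} [Fintype α] {n : ℕ} (v : α → M) (xs : Fin n → M)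
    (a : M) (c : Option (α ⊕ Fin (n + 1)) → ℤ) :
    Fintype.linearCombination ℤ (liftTuple h (Sum.elim v (Fin.snoc xs a : Fin (n + 1) → M))) c =
      c (some (Sum.inr (Fin.last n))) • Cover.lift h a +
        Fintype.linearCombination ℤ (liftTuple h (Sum.elim v xs))
          (fun o => c (o.map (Sum.map id Fin.castSucc))) := by
  simp only [Fintype.linearCombination_apply, Fintype.sum_option, Fintype.sum_sum_type,
    Fin.sum_univ_castSucc, liftTuple, Sum.elim_inl, Sum.elim_inr, Fin.snoc_castSucc,
    Fin.snoc_last, Option.map_some, Option.map_none, Sum.map_inl, Sum.map_inr, id]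
  abel

end liftTuple

open Classical in
theorem Interprets.exists_term [LOp.Structure M] {G : AddSubgroup M} (hI : Interprets O G)
    (h : IsOrientation O) {β : Type*} [Fintype β] (t : LOp.Term β) : ∃ c : Option β → ℤ,
      ∀ v : β → M, t.realize v =
        Cover.proj h (Fintype.linearCombination ℤ (liftTuple h v) c) := by
  induction t with
  | var i =>
    refine ⟨Pi.single (some i) 1, fun v => ?_⟩
    rw [Fintype.linearCombination_apply_single]
    simp [liftTuple]
  | func f ts ih =>
    choose c hc using ih
    rcases f with f | f
    · cases f with
      | zero => exact ⟨0, fun v => (hI.zero _).trans (by simp)⟩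
      | neg => exact ⟨-c 0, fun v => (hI.neg _).trans (by simp [hc])⟩
      | add => exact ⟨c 0 + c 1, fun v => (hI.add _).trans (by simp [hc])⟩
    · exact f.elim

theorem Interprets.exists_bound_equal [LOp.Structure M] {G : AddSubgroup M} (hI : Interprets O G)
    (h : IsOrientation O) {β : Type*} [Fintype β] (s t : LOp.Term β) : ∃ C : ℤ, ∀ v v' : β → M,
      Eqv (G.comap (Cover.proj h)) C (liftTuple h v) (liftTuple h v') →
        (s.realize v = t.realize v ↔ s.realize v' = t.realize v') := by
  classical
  obtain ⟨c1, h1⟩ := hI.exists_term h s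
  obtain ⟨c2, h2⟩ := hI.exists_term h t
  let K := ∑ o, |(c1 - c2) o|
  refine ⟨K + K, fun v v' hE => ?_⟩
  have key : ∀ v : β → M, s.realize v = t.realize v ↔ ∃ m : ℤ, |m| ≤ K ∧
      Fintype.linearCombination ℤ (liftTuple h v) (c1 - c2 + Pi.single none m) = 0 := by
    intro v
    rw [h1, h2, ← sub_eq_zero, ← map_sub, ← map_sub, Cover.proj_eq_zero]
    constructor
    · rintro ⟨m, hm⟩
      have e : Fintype.linearCombination ℤ (liftTuple h v) (c1 - c2) +
          (-m) • Cover.one h = 0 := by rw [hm]; simp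
      refine ⟨-m, liftTuple.bound_int v _ e.ge (e.trans_lt Cover.one_pos), ?_⟩
      rw [liftTuple.linearCombination_add_int, e]
    · rintro ⟨m, -, hm⟩
      rw [liftTuple.linearCombination_add_int] at hm
      exact ⟨-m, by rw [neg_smul]; exact eq_neg_of_add_eq_zero_left hm⟩
  rw [key, key]
  refine exists_congr fun m => and_congr_right fun hm => ?_
  have hb : Bounded (K + K) (c1 - c2 + Pi.single none m) :=
    (liftTuple.bounded_sum _).add (Bounded.single none hm)
  exact hE.eq_zero_iff hb

theorem Interprets.exists_bound_orient [LOp.Structure M] {G : AddSubgroup M}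
    (hI : Interprets O G) (h : IsOrientation O) {β : Type*} [Fintype β] (r s t : LOp.Term β) :
    ∃ C : ℤ, ∀ v v' : β → M,
      Eqv (G.comap (Cover.proj h)) C (liftTuple h v) (liftTuple h v') →
        (O (r.realize v) (s.realize v) (t.realize v) ↔
          O (r.realize v') (s.realize v') (t.realize v')) := by
  classical
  obtain ⟨c1, h1⟩ := hI.exists_term h r
  obtain ⟨c2, h2⟩ := hI.exists_term h s
  obtain ⟨c3, h3⟩ := hI.exists_term h t
  let d := c2 - c1
  let e := c3 - c1
  let K := ∑ o, |d o|
  let L := ∑ o, |e o|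
  have hK : 0 ≤ K := Finset.sum_nonneg fun _ _ => abs_nonneg _
  have hL : 0 ≤ L := Finset.sum_nonneg fun _ _ => abs_nonneg _
  -- The three combinations below have coefficients bounded by `2K`, `2K + 2L` and `2L + 1`.
  refine ⟨K + K + (L + L) + 1, fun v v' hE => ?_⟩
  have key : ∀ v : β → M, O (r.realize v) (s.realize v) (t.realize v) ↔
      ∃ m n : ℤ, (|m| ≤ K ∧ |n| ≤ L) ∧
      0 < Fintype.linearCombination ℤ (liftTuple h v) (d + Pi.single none m) ∧
      0 < Fintype.linearCombination ℤ (liftTuple h v)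
        ((e + Pi.single none n) - (d + Pi.single none m)) ∧
      0 < Fintype.linearCombination ℤ (liftTuple h v)
        (Pi.single none 1 - (e + Pi.single none n)) := by
    intro v
    rw [h.base, h1, h2, h3, ← map_sub, ← map_sub, ← map_sub, ← map_sub,
      Cover.orient_zero_iff_exists (h := h)]
    refine exists_congr fun m => exists_congr fun n => ?_
    rw [map_sub _ (e + _), map_sub _ (Pi.single none 1), sub_pos, sub_pos,
      liftTuple.linearCombination_add_int, liftTuple.linearCombination_add_int,
      Fintype.linearCombination_apply_single, liftTuple, one_smul, iff_and_self]
    rintro ⟨p, q, r⟩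
    exact ⟨liftTuple.bound_int v _ p.le (q.trans r), liftTuple.bound_int v _ (p.trans q).le r⟩
  rw [key, key]
  refine exists_congr fun m => exists_congr fun n => and_congr_right fun hmn => ?_
  have b1 : Bounded (K + K) (d + Pi.single none m) :=
    (liftTuple.bounded_sum _).add (Bounded.single none hmn.1)
  have b2 : Bounded (L + L) (e + Pi.single none n) :=
    (liftTuple.bounded_sum _).add (Bounded.single none hmn.2)
  have b3 : Bounded 1 (Pi.single none 1 : Option β → ℤ) := Bounded.single none (by simp)
  rw [hE.pos _ (b1.mono (by linarith)), hE.pos _ ((b2.sub b1).mono (by linarith)),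
    hE.pos _ ((b3.sub b2).mono (by linarith))]

theorem Interprets.exists_bound_pred [LOp.Structure M] {G : AddSubgroup M} (hI : Interprets O G)
    (h : IsOrientation O) {β : Type*} [Fintype β] (t : LOp.Term β) : ∃ C : ℤ, ∀ v v' : β → M,
      Eqv (G.comap (Cover.proj h)) C (liftTuple h v) (liftTuple h v') →
        (t.realize v ∈ G ↔ t.realize v' ∈ G) := by
  obtain ⟨c, hc⟩ := hI.exists_term h t
  refine ⟨∑ o, |c o|, fun v v' hE => ?_⟩
  rw [hc, hc]
  exact hE.mem c (liftTuple.bounded_sum c)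

theorem Interprets.exists_eqv_snoc {G : AddSubgroup M} (hA : IsOrientedPair O G)
    (h : IsOrientation O) {α : Type*} [Fintype α] (n : ℕ) (C : ℤ) : ∃ E : ℤ,
      ∀ (v : α → M) (xs : Fin n → M) (v' : α → M) (xs' : Fin n → M),
      Eqv (G.comap (Cover.proj h)) E (liftTuple h (Sum.elim v xs))
        (liftTuple h (Sum.elim v' xs')) → ∀ a : M, ∃ a' : M,
      Eqv (G.comap (Cover.proj h)) C
        (liftTuple h (Sum.elim v (Fin.snoc xs a : Fin (n + 1) → M)))
        (liftTuple h (Sum.elim v' (Fin.snoc xs' a' : Fin (n + 1) → M))) := by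
  classical
  obtain ⟨E, hE⟩ := (hA.isDensePair (h := h)).exists_extension (Option (α ⊕ Fin n)) none
    (le_max_right C 1)
  refine ⟨E, fun v xs v' xs' hvv a => ?_⟩
  obtain ⟨w, hw⟩ := hE _ _ rfl rfl hvv (Cover.lift h a)
  -- To be the lift of an element of `M`, `w` must lie in `[0, one)`. This is tested by the signs of
  -- `-w` and `one - w`, whose coefficients require a bound of at least `1`.
  have h1C : |(-1 : ℤ)| ≤ max C 1 := by simp
  have w0 : 0 ≤ w := by
    have := (hw (-1) 0 h1C (fun _ => by simp)).1.not
    simpa [Cover.lift_nonneg] using this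
  have w1 : w < Cover.one h := by
    have := (hw (-1) (Pi.single none 1) h1C (Bounded.single none (by simp))).1
    rw [Fintype.linearCombination_apply_single, Fintype.linearCombination_apply_single] at this
    simpa [liftTuple, Cover.lift_lt_one] using this
  refine ⟨Cover.proj h w, ?_⟩
  have hb : ∀ c : Option (α ⊕ Fin (n + 1)) → ℤ, Bounded C c →
      |c (some (Sum.inr (Fin.last n)))| ≤ max C 1 ∧
      Bounded (max C 1) (fun o : Option (α ⊕ Fin n) => c (o.map (Sum.map id Fin.castSucc))) :=
    fun c hc => ⟨(hc _).trans (le_max_left _ _), fun o => (hc _).trans (le_max_left _ _)⟩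
  constructor
  · intro c hc
    rw [liftTuple.linearCombination_snoc, liftTuple.linearCombination_snoc, ← Cover.eq_lift w0 w1]
    exact (hw _ _ (hb c hc).1 (hb c hc).2).1
  · intro c hc
    rw [liftTuple.linearCombination_snoc, liftTuple.linearCombination_snoc, ← Cover.eq_lift w0 w1]
    exact (hw _ _ (hb c hc).1 (hb c hc).2).2.1
  · intro c hc N hN hNC
    rw [liftTuple.linearCombination_snoc, liftTuple.linearCombination_snoc, ← Cover.eq_lift w0 w1]
    exact (hw _ _ (hb c hc).1 (hb c hc).2).2.2 N hN (hNC.trans (le_max_left _ _))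

/-- The truth value of a formula only depends on finitely many atomic conditions. -/
theorem Interprets.exists_bound [LOp.Structure M] {G : AddSubgroup M} (hI : Interprets O G)
    (hA : IsOrientedPair O G) (h : IsOrientation O) {α : Type*} [Fintype α] {n : ℕ}
    (φ : LOp.BoundedFormula α n) : ∃ C : ℤ,
      ∀ (v : α → M) (xs : Fin n → M) (v' : α → M) (xs' : Fin n → M),
      Eqv (G.comap (Cover.proj h)) C (liftTuple h (Sum.elim v xs))
        (liftTuple h (Sum.elim v' xs')) → (φ.Realize v xs ↔ φ.Realize v' xs') := by
  induction φ with
  | falsum => exact ⟨0, fun _ _ _ _ _ => Iff.rfl⟩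
  | equal s t =>
    obtain ⟨C, hC⟩ := hI.exists_bound_equal h s t
    exact ⟨C, fun v xs v' xs' hE => hC _ _ hE⟩
  | rel R ts =>
    rcases R with R | R
    · cases R
      obtain ⟨C, hC⟩ := hI.exists_bound_orient h (ts 0) (ts 1) (ts 2)
      refine ⟨C, fun v xs v' xs' hE => ?_⟩
      exact (hI.orient _).trans ((hC _ _ hE).trans
        (hI.orient fun i => (ts i).realize (Sum.elim v' xs')).symm)
    · cases R
      obtain ⟨C, hC⟩ := hI.exists_bound_pred h (ts 0)
      refine ⟨C, fun v xs v' xs' hE => ?_⟩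
      exact (hI.pred _).trans ((hC _ _ hE).trans
        (hI.pred fun i => (ts i).realize (Sum.elim v' xs')).symm)
  | imp φ ψ ih1 ih2 =>
    obtain ⟨C, hC⟩ := ih1
    obtain ⟨D, hD⟩ := ih2
    refine ⟨max C D, fun v xs v' xs' hE => ?_⟩
    rw [BoundedFormula.realize_imp, BoundedFormula.realize_imp,
      hC _ _ _ _ (hE.mono (le_max_left _ _)), hD _ _ _ _ (hE.mono (le_max_right _ _))]
  | @all n φ ih =>
    obtain ⟨C, hC⟩ := ih
    obtain ⟨E, hE⟩ := Interprets.exists_eqv_snoc (α := α) hA h n C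
    refine ⟨E, fun v xs v' xs' hvv => ?_⟩
    rw [BoundedFormula.realize_all, BoundedFormula.realize_all]
    constructor
    · intro H a'
      obtain ⟨a, ha⟩ := hE _ _ _ _ hvv.symm a'
      exact (hC _ _ _ _ ha).2 (H a)
    · intro H a
      obtain ⟨a', ha⟩ := hE _ _ _ _ hvv a
      exact (hC _ _ _ _ ha).2 (H a')

end Formulas

/-! ### Counting -/

/-- The sets form a chain, so each is determined by its cardinality in `{0, …, k}`. -/
theorem ncard_range_lt {B Y : Type*} [LinearOrder B] {k : ℕ} (f : Fin k → B) (g : Y → B) :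
    (Set.range fun y => {i | g y < f i}).ncard ≤ k + 1 := by
  have := Set.ncard_le_ncard_of_injOn (s := Set.range fun y => {i | g y < f i})
    (t := Set.Iic k) Set.ncard ?_ ?_ (Set.finite_Iic k)
  · simpa using this
  · rintro _ ⟨y, rfl⟩
    simpa using Set.ncard_le_card {i | g y < f i}
  · rintro _ ⟨y, rfl⟩ _ ⟨y', rfl⟩ hyy
    rcases le_total (g y) (g y') with hle | hle
    · exact (Set.eq_of_subset_of_ncard_le (fun i hi => hle.trans_lt hi) hyy.le).symm
    · exact Set.eq_of_subset_of_ncard_le (fun i hi => hle.trans_lt hi) hyy.ge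

/-- A set containing `j` is the class of `j` under congruence of `f` modulo `K`; besides the empty
set there are at most `k` of these. -/
theorem ncard_range_mem {B Y : Type*} [AddCommGroup B] (K : AddSubgroup B) {k : ℕ}
    (f : Fin k → B) (g : Y → B) :
    (Set.range fun y => {i | f i + g y ∈ K}).ncard ≤ k + 1 := by
  have hsub : (Set.range fun y => {i | f i + g y ∈ K}) ⊆
      insert ∅ (Set.range fun j => {i | f i - f j ∈ K}) := by
    rintro _ ⟨y, rfl⟩
    rcases Set.eq_empty_or_nonempty {i | f i + g y ∈ K} with he | ⟨j, hj⟩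
    · exact Or.inl he
    · refine Or.inr ⟨j, Set.ext fun i => ?_⟩
      have : f i - f j = (f i + g y) - (f j + g y) := by abel
      rw [Set.mem_ofPred_eq, Set.mem_ofPred_eq, this]
      rw [sub_eq_add_neg]
      exact K.add_mem_cancel_right (K.neg_mem hj)
  refine (Set.ncard_le_ncard hsub).trans ((Set.ncard_insert_le _ _).trans ?_)
  gcongr
  rw [← Set.image_univ]
  exact (Set.ncard_image_le).trans (by simp)

theorem exists_pow_lt_two_pow (N : ℕ) : ∃ k : ℕ, (k + 1) ^ N < 2 ^ k := by
  have h1 := (tendsto_pow_const_div_const_pow_of_one_lt N (one_lt_two : (1 : ℝ) < 2)).comp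
    (Filter.tendsto_add_atTop_nat 1)
  obtain ⟨k, hk⟩ := (h1.eventually (gt_mem_nhds (by norm_num : (0 : ℝ) < 1 / 2))).exists
  refine ⟨k, ?_⟩
  simp only [Function.comp_apply] at hk
  rw [div_lt_iff₀ (by positivity), pow_succ] at hk
  have : ((k : ℝ) + 1) ^ N < 2 ^ k := by push_cast at hk; linarith
  exact_mod_cast this

/-- A family of subsets of `Fin k` indexed by `Set (Fin k)` and determined by finitely many
families with at most `k + 1` members each forces `2 ^ k ≤ (k + 1) ^ N`. -/
theorem two_pow_le_of_patterns {T : Type*} [Finite T] {k : ℕ}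
    (pat : T → Set (Fin k) → Set (Fin k)) (hcard : ∀ t, (Set.range (pat t)).ncard ≤ k + 1)
    (hinj : ∀ I J, (∀ t, pat t I = pat t J) → I = J) : 2 ^ k ≤ (k + 1) ^ Nat.card T := by
  have := Fintype.ofFinite T
  have hle := Nat.card_le_card_of_injective
    (fun (I : Set (Fin k)) (t : T) => (⟨pat t I, I, rfl⟩ : Set.range (pat t)))
    (fun I J hIJ => hinj I J fun t => congrArg Subtype.val (congrFun hIJ t))
  rw [Nat.card_pi] at hle
  have h2 : Nat.card (Set (Fin k)) = 2 ^ k := by simp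
  rw [h2] at hle
  refine hle.trans ?_
  rw [Nat.card_eq_fintype_card, ← Finset.card_univ]
  exact Finset.prod_le_pow_card _ _ _ fun t _ =>
    (Nat.card_coe_set_eq _).trans_le (hcard t)

theorem Interprets.not_hasIP {M : Type*} [AddCommGroup M]
    {O : M → M → M → Prop} [LOp.Structure M] {G : AddSubgroup M} (hI : Interprets O G)
    (hA : IsOrientedPair O G) {m n : ℕ} (φ : LOp.Formula (Fin m ⊕ Fin n)) : ¬ HasIP M φ := by
  intro hIP
  let h := hA.orientation
  obtain ⟨C, hC⟩ := hI.exists_bound hA h φ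
  let κ := Option ((Fin m ⊕ Fin n) ⊕ Fin 0)
  -- An index of `T` is an atomic condition: coefficients together with a tag for positivity
  -- (`none`), membership (`some none`) or divisibility by `N`.
  let T := {c : κ → ℤ // Bounded C c} × Option (Option (Set.Icc 1 C))
  have : Finite {c : κ → ℤ // Bounded C c} := (Bounded.finite C).to_subtype
  have : Finite T := inferInstance
  obtain ⟨k, hk⟩ := exists_pow_lt_two_pow (Nat.card T)
  obtain ⟨a, b, hab⟩ := hIP k
  let z : Fin k → Set (Fin k) → κ → Cover h :=
    fun i I => liftTuple h (Sum.elim (Sum.elim (a i) (b I)) default)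
  let P : Option (Option (Set.Icc 1 C)) → Cover h → Prop := fun o x => match o with
    | none => 0 < x
    | some none => x ∈ G.comap (Cover.proj h)
    | some (some N) => ∃ y, x = (N : ℤ) • y
  refine absurd (two_pow_le_of_patterns (T := T)
    (fun t I => {i | P t.2 (Fintype.linearCombination ℤ (z i I) t.1)}) ?_ ?_) (not_le.2 hk)
  · rintro ⟨c, o⟩
    let f : Fin k → Cover h := fun i => ∑ j, c.1 (some (Sum.inl (Sum.inl j))) • Cover.lift h (a i j)
    let g : Set (Fin k) → Cover h := fun I => c.1 none • Cover.one h +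
      ∑ j, c.1 (some (Sum.inl (Sum.inr j))) • Cover.lift h (b I j)
    have hfg : ∀ i I, Fintype.linearCombination ℤ (z i I) c.1 = f i + g I := by
      intro i I
      simp only [κ, z, f, g, Fintype.linearCombination_apply, Fintype.sum_option,
        Fintype.sum_sum_type, liftTuple, Sum.elim_inl, Sum.elim_inr, Finset.univ_eq_empty,
        Finset.sum_empty]
      abel
    simp only [hfg]
    match o with
    | none =>
      have := ncard_range_lt f (fun I => -g I)
      simpa only [P, neg_lt_iff_pos_add] using this
    | some none => exact ncard_range_mem _ f g
    | some (some N) =>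
      have := ncard_range_mem (zsmulAddGroupHom (α := Cover h) (N : ℤ)).range f g
      simpa only [P, AddMonoidHom.mem_range, zsmulAddGroupHom_apply, eq_comm] using this
  · intro I J hIJ
    ext i
    have hP : ∀ (c : κ → ℤ) (hc : Bounded C c) o,
        P o (Fintype.linearCombination ℤ (z i I) c) ↔
          P o (Fintype.linearCombination ℤ (z i J) c) :=
      fun c hc o => Set.ext_iff.1 (hIJ ⟨⟨c, hc⟩, o⟩) i
    rw [← hab i I, ← hab i J]
    exact hC _ _ _ _ ⟨fun c hc => hP c hc none, fun c hc => hP c hc (some none),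
      fun c hc N hN hNC => hP c hc (some (some ⟨N, by omega, hNC⟩))⟩

/-! ### Models of the theories -/

/-- The symbols of `L_O` are interpreted by the group operations and the orientation `O`. -/
structure InterpretsLO {N : Type*} [LO.Structure N] [AddCommGroup N] (O : N → N → N → Prop) :
    Prop where
  zero : ∀ v : Fin 0 → N, Structure.funMap (L := LO) GroupFunc.zero v = 0
  neg : ∀ v : Fin 1 → N, Structure.funMap (L := LO) GroupFunc.neg v = -v 0
  add : ∀ v : Fin 2 → N, Structure.funMap (L := LO) GroupFunc.add v = v 0 + v 1
  orient : ∀ v : Fin 3 → N, Structure.RelMap (L := LO) OrientRel.orient v ↔ O (v 0) (v 1) (v 2)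

theorem realize_zeroT_eq {N : Type*} [LO.Structure N] {α : Type} (v : α → N) :
    zeroT.realize v = Structure.funMap (L := LO) GroupFunc.zero (default : Fin 0 → N) :=
  Term.realize_constants

theorem realize_negT_eq {N : Type*} [LO.Structure N] {α : Type} (v : α → N) (t : LO.Term α) :
    (negT t).realize v = Structure.funMap (L := LO) GroupFunc.neg ![t.realize v] :=
  Term.realize_functions_apply₁

theorem realize_addT_eq {N : Type*} [LO.Structure N] {α : Type} (v : α → N) (s t : LO.Term α) :
    (addT s t).realize v =
      Structure.funMap (L := LO) GroupFunc.add ![s.realize v, t.realize v] :=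
  Term.realize_functions_apply₂

/-- The additive group of a model of the group axioms. -/
@[reducible]
noncomputable def groupOfModel (N : Type*) [LO.Structure N] (hN : N ⊨ groupAxioms) : AddCommGroup N :=
  letI : Zero N := ⟨Structure.funMap (L := LO) GroupFunc.zero (default : Fin 0 → N)⟩
  letI : Neg N := ⟨fun x => Structure.funMap (L := LO) GroupFunc.neg ![x]⟩
  letI : Add N := ⟨fun x y => Structure.funMap (L := LO) GroupFunc.add ![x, y]⟩
  have h : (∀ x y z : N, x + y + z = x + (y + z)) ∧ (∀ x y : N, x + y = y + x) ∧
      (∀ x : N, x + 0 = x) ∧ ∀ x : N, x + -x = 0 := by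
    rw [Theory.model_iff] at hN
    simp only [groupAxioms, Set.mem_insert_iff, Set.mem_singleton_iff, forall_eq_or_imp,
      forall_eq] at hN
    obtain ⟨h1, h2, h3, h4⟩ := hN
    refine ⟨fun x y z => ?_, fun x y => ?_, fun x => ?_, fun x => ?_⟩
    · have := h1 x y z
      rw [BoundedFormula.realize_bdEqual] at this
      rwa [realize_addT_eq, realize_addT_eq, realize_addT_eq, realize_addT_eq] at this
    · have := h2 x y
      rw [BoundedFormula.realize_bdEqual] at this
      rwa [realize_addT_eq, realize_addT_eq] at this
    · have := h3 x
      rw [BoundedFormula.realize_bdEqual] at this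
      rwa [realize_addT_eq, realize_zeroT_eq] at this
    · have := h4 x
      rw [BoundedFormula.realize_bdEqual] at this
      rwa [realize_addT_eq, realize_negT_eq, realize_zeroT_eq] at this
  { add_assoc := h.1
    zero_add := fun x => by rw [h.2.1, h.2.2.1]
    add_zero := h.2.2.1
    add_comm := h.2.1
    neg_add_cancel := fun x => by rw [h.2.1, h.2.2.2]
    nsmul := nsmulRec
    zsmul := zsmulRec }

namespace InterpretsLO

variable {N : Type*} [LO.Structure N] [AddCommGroup N] {O : N → N → N → Prop}

theorem realize_zeroT (hI : InterpretsLO O) {α : Type} (v : α → N) : zeroT.realize v = 0 :=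
  hI.zero _

theorem realize_negT (hI : InterpretsLO O) {α : Type} (v : α → N) (t : LO.Term α) :
    (negT t).realize v = -t.realize v := hI.neg _

theorem realize_addT (hI : InterpretsLO O) {α : Type} (v : α → N) (s t : LO.Term α) :
    (addT s t).realize v = s.realize v + t.realize v := hI.add _

theorem realize_nsmulT (hI : InterpretsLO O) {α : Type} (v : α → N) (n : ℕ) (t : LO.Term α) :
    (nsmulT n t).realize v = n • t.realize v := by
  induction n with
  | zero => rw [zero_nsmul]; exact hI.realize_zeroT v
  | succ n ih => rw [succ_nsmul, nsmulT, hI.realize_addT, ih]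

theorem realize_orientF (hI : InterpretsLO O) {α : Type} {n : ℕ} (v : α → N) (xs : Fin n → N)
    (r s t : LO.Term (α ⊕ Fin n)) : (orientF r s t).Realize v xs ↔
      O (r.realize (Sum.elim v xs)) (s.realize (Sum.elim v xs)) (t.realize (Sum.elim v xs)) :=
  hI.orient _

theorem realize_ltF (hI : InterpretsLO O) {α : Type} {n : ℕ} (v : α → N) (xs : Fin n → N)
    (s t : LO.Term (α ⊕ Fin n)) : (ltF s t).Realize v xs ↔
      s.realize (Sum.elim v xs) ≠ t.realize (Sum.elim v xs) ∧
        O 0 (s.realize (Sum.elim v xs)) (t.realize (Sum.elim v xs)) := by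
  rw [ltF, BoundedFormula.realize_inf, hI.realize_orientF, hI.realize_zeroT]
  rfl

theorem isOrientation (hI : InterpretsLO O) (hN : N ⊨ orientationAxioms) : IsOrientation O := by
  rw [Theory.model_iff] at hN
  simp only [orientationAxioms, Set.mem_insert_iff, Set.mem_singleton_iff, forall_eq_or_imp,
    forall_eq, Sentence.Realize, Formula.Realize, BoundedFormula.realize_all,
    BoundedFormula.realize_imp, BoundedFormula.realize_inf, BoundedFormula.realize_sup,
    BoundedFormula.realize_not, BoundedFormula.realize_bdEqual,
    hI.realize_orientF, hI.realize_ltF, hI.realize_addT, hI.realize_zeroT] at hN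
  obtain ⟨h1, h2, h3, h4, h5⟩ := hN
  have h2' : ∀ {x y z}, O x y z → x ≠ y ∧ y ≠ z ∧ x ≠ z := fun {x y z} H => by
    have := h2 x y z H
    exact ⟨this.1.1, this.1.2, this.2⟩
  refine ⟨fun {x y z} H => h1 x y z H, h2', fun {x y z} w H => h3 x y z w H,
    fun {x y z} H H' => (h4 x y z ⟨(h2' H).2.1, H⟩ ⟨(h2' H').2.1, H'⟩).2,
    fun {x y} hx hy hxy => ?_⟩
  exact (h5 x y hx hy hxy).imp And.right And.right

theorem realize_regDenseAxiom (hI : InterpretsLO O) {p : ℕ} (hN : N ⊨ regDenseAxiom p) (a b : N)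
    (hab : O 0 a b) : ∃ c, O a (p • c) b ∧
      ∀ i : ℕ, 1 ≤ i → i ≤ p - 1 → O 0 (i • c) ((i + 1) • c) := by
  simp only [regDenseAxiom, Sentence.Realize, Formula.Realize, BoundedFormula.realize_all,
    BoundedFormula.realize_imp, BoundedFormula.realize_ex, BoundedFormula.realize_inf,
    BoundedFormula.realize_iInf,
    hI.realize_orientF, hI.realize_ltF, hI.realize_nsmulT, hI.realize_zeroT] at hN
  obtain ⟨c, h1, h2⟩ := hN a b hab
  exact ⟨c, h1, fun i hi hip => (h2 ⟨i, hi, hip⟩).2⟩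

theorem realize_divAxiom (hI : InterpretsLO O) {p : ℕ} (hN : N ⊨ divAxiom p) (a : N) :
    ∃ b : N, p • b = a := by
  simp only [divAxiom, Sentence.Realize, Formula.Realize, BoundedFormula.realize_all,
    BoundedFormula.realize_ex, BoundedFormula.realize_bdEqual, hI.realize_nsmulT] at hN
  exact hN a

theorem realize_torsionFreeAxiom (hI : InterpretsLO O) {n : ℕ} (hN : N ⊨ torsionFreeAxiom n)
    (a : N) (ha : n • a = 0) : a = 0 := by
  simp only [torsionFreeAxiom, Sentence.Realize, Formula.Realize, BoundedFormula.realize_all,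
    BoundedFormula.realize_imp, BoundedFormula.realize_bdEqual, hI.realize_nsmulT,
    hI.realize_zeroT] at hN
  exact hN a ha

end InterpretsLO

/-! ### Relativization to the subgroup. -/

section Restrict

variable {M : Type*} [AddCommGroup M] {O : M → M → M → Prop} {G : AddSubgroup M}

/-- The `L_O`-structure induced on a subgroup. -/
@[reducible]
def subgroupStructure (O : M → M → M → Prop) (G : AddSubgroup M) : LO.Structure G where
  funMap := fun {_} f v => match f, v with
    | .zero, _ => 0
    | .neg, v => -v 0
    | .add, v => v 0 + v 1
  RelMap := fun {_} R v => match R, v with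
    | .orient, v => O (v 0) (v 1) (v 2)

theorem interpretsLO_subgroup :
    letI := subgroupStructure O G
    InterpretsLO (fun x y z : G => O x y z) :=
  letI := subgroupStructure O G
  ⟨fun _ => rfl, fun _ => rfl, fun _ => rfl, fun _ => Iff.rfl⟩

variable [LOp.Structure M]

theorem Interprets.realize_onTerm (hI : Interprets O G) {α : Type*} (t : LO.Term α) (v : α → G) :
    letI := subgroupStructure O G
    (incl.onTerm t).realize (fun i => (v i : M)) = (t.realize v : G) := by
  let := subgroupStructure O G
  induction t with
  | var i => rfl
  | func f ts ih =>
    cases f with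
    | zero => exact hI.zero _
    | neg => exact (hI.neg _).trans (congrArg _ (ih 0))
    | add => exact (hI.add _).trans (congrArg₂ _ (ih 0) (ih 1))

theorem Interprets.realize_predF (hI : Interprets O G) {α : Type} {n : ℕ} (v : α → M)
    (xs : Fin n → M) (t : LOp.Term (α ⊕ Fin n)) :
    (predF t).Realize v xs ↔ t.realize (Sum.elim v xs) ∈ G :=
  hI.pred _

/-- Makes the relativized axioms available as ordinary axioms of the structure `G`. -/
theorem Interprets.realize_restrictV (hI : Interprets O G) {α : Type} {n : ℕ}
    (φ : LO.BoundedFormula α n) (v : α → G) (xs : Fin n → G) :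
    letI := subgroupStructure O G
    (restrictV (incl.onBoundedFormula φ)).Realize (fun i => (v i : M)) (fun i => (xs i : M)) ↔
      φ.Realize v xs := by
  let := subgroupStructure O G
  have hterm : ∀ {n : ℕ} (t : LO.Term (α ⊕ Fin n)) (xs : Fin n → G),
      (incl.onTerm t).realize (Sum.elim (fun i => (v i : M)) (fun i => (xs i : M))) =
        (t.realize (Sum.elim v xs) : G) := by
    intro n t xs
    rw [← hI.realize_onTerm t]
    congr 1
    ext i
    cases i <;> rfl
  induction φ with
  | falsum => exact Iff.rfl
  | equal s t =>
    change (incl.onTerm s).realize _ = (incl.onTerm t).realize _ ↔ s.realize _ = t.realize _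
    rw [hterm, hterm, Subtype.ext_iff]
  | rel R ts =>
    cases R
    refine (hI.orient _).trans ?_
    change O ((incl.onTerm (ts 0)).realize _) ((incl.onTerm (ts 1)).realize _)
      ((incl.onTerm (ts 2)).realize _) ↔ _
    rw [hterm, hterm, hterm]
    exact Iff.rfl
  | imp φ ψ ih1 ih2 => exact imp_congr (ih1 xs) (ih2 xs)
  | @all n φ ih =>
    have hs : ∀ g : G, (Fin.snoc (fun i => (xs i : M)) (g : M) : Fin (n + 1) → M) =
        fun i => ((Fin.snoc xs g : Fin (n + 1) → G) i : M) := by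
      intro g
      ext i
      refine Fin.lastCases ?_ (fun j => ?_) i <;> simp
    change (∀ a : M, (predF (Term.var (Sum.inr (Fin.last n)))).Realize _ _ →
      (restrictV (incl.onBoundedFormula φ)).Realize _ _) ↔ ∀ g : G, _
    constructor
    · intro H g
      have := H g ((hI.realize_predF _ _ _).2 (by simp))
      rw [hs] at this
      exact (ih _).1 this
    · intro H a ha
      have ha' : a ∈ G := by simpa using (hI.realize_predF _ _ _).1 ha
      have := (ih _).2 (H ⟨a, ha'⟩)
      rw [← hs] at this
      exact this

end Restrict

/-- Every model of the theory of pairs is a dense pair of oriented groups. -/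
theorem exists_orientedPair (M : Type*) [LOp.Structure M] [M ⊨ pairTheory] :
    ∃ (_ : AddCommGroup M) (O : M → M → M → Prop) (G : AddSubgroup M),
      Interprets O G ∧ IsOrientedPair O G := by
  have hM : M ⊨ pairTheory := inferInstance
  rw [Theory.model_iff] at hM
  let := incl.reduct M
  have : incl.IsExpansionOn M := inferInstance
  have hLO : ∀ φ ∈ divTorsionFreeTheory, M ⊨ φ := fun φ hφ =>
    (LHom.realize_onSentence (ψ := φ) M incl).1
      (hM _ (by exact Or.inl (Or.inl (Or.inl (Or.inl ⟨φ, hφ, rfl⟩)))))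
  have hres : ∀ φ ∈ divTorsionFreeTheory, M ⊨ (restrictV (incl.onSentence φ) : LOp.Sentence) :=
    fun φ hφ => hM _ (by exact Or.inl (Or.inl (Or.inl (Or.inr ⟨_, ⟨φ, hφ, rfl⟩, rfl⟩))))
  have hsub : ∀ φ ∈ subgroupAxioms, M ⊨ φ := fun φ hφ => hM _ (Or.inl (Or.inl (Or.inr hφ)))
  have hdense : M ⊨ denseAxiom := hM _ (Or.inl (Or.inr rfl))
  have hindex : ∀ n, M ⊨ indexGeAxiom n := fun n => hM _ (Or.inr ⟨n, rfl⟩)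
  let := groupOfModel M (Theory.model_iff _ |>.2 fun φ hφ =>
    hLO φ (Or.inl (Or.inl (Or.inl (Or.inl hφ)))))
  let O : M → M → M → Prop := fun x y z => Structure.RelMap (L := LO) OrientRel.orient ![x, y, z]
  have hI : InterpretsLO O := by
    refine ⟨fun v => ?_, fun v => ?_, fun v => ?_, fun v => ?_⟩
    · exact congrArg _ (Subsingleton.elim _ _)
    · exact congrArg _ (funext fun i => by fin_cases i; rfl)
    · exact congrArg _ (funext fun i => by fin_cases i <;> rfl)
    · have : v = ![v 0, v 1, v 2] := funext fun i => by fin_cases i <;> rfl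
      change Structure.RelMap _ v ↔ Structure.RelMap _ ![v 0, v 1, v 2]
      rw [← this]
  have hpred : ∀ {n : ℕ} (xs : Fin n → M) (t : LOp.Term (Empty ⊕ Fin n)),
      (predF t).Realize default xs ↔ Structure.RelMap (L := LOp) (Sum.inr PredRel.V)
        ![t.realize (Sum.elim default xs)] := by
    intro n xs t
    exact BoundedFormula.realize_rel₁
  simp only [subgroupAxioms, Set.mem_insert_iff, Set.mem_singleton_iff, forall_eq_or_imp,
    forall_eq, Sentence.Realize, Formula.Realize, BoundedFormula.realize_all,
    BoundedFormula.realize_imp, hpred, LHom.realize_onTerm, hI.realize_addT, hI.realize_negT,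
    hI.realize_zeroT] at hsub
  obtain ⟨g1, g2, g3⟩ := hsub
  let G : AddSubgroup M :=
    { carrier := {x | Structure.RelMap (L := LOp) (Sum.inr PredRel.V) ![x]}
      zero_mem' := g1
      neg_mem' := fun {x} hx => g2 x hx
      add_mem' := fun {x y} hx hy => g3 x y hx hy }
  have hG : Interprets O G := by
    refine ⟨hI.zero, hI.neg, hI.add, hI.orient, fun v => ?_⟩
    have : v = ![v 0] := funext fun i => by fin_cases i; rfl
    change Structure.RelMap _ v ↔ Structure.RelMap _ ![v 0]
    rw [← this]
  refine ⟨inferInstance, O, G, hG, ?_⟩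
  let := subgroupStructure O G
  have hGI : InterpretsLO (fun x y z : G => O x y z) := interpretsLO_subgroup
  have hGM : ∀ φ ∈ divTorsionFreeTheory, G ⊨ φ := fun φ hφ => by
    have h1 := hG.realize_restrictV φ default default
    refine h1.1 ?_
    have h2 := hres φ hφ
    unfold Sentence.Realize Formula.Realize at h2
    have e1 : (default : Empty → M) = fun i => ((default : Empty → G) i : M) :=
      Subsingleton.elim _ _
    have e2 : (default : Fin 0 → M) = fun i => ((default : Fin 0 → G) i : M) :=
      Subsingleton.elim _ _
    rw [e1, e2] at h2
    exact h2
  have hreg : ∀ p : ℕ, p.Prime → regDenseAxiom p ∈ divTorsionFreeTheory :=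
    fun p hp => Or.inl (Or.inl (Or.inr ⟨p, hp, rfl⟩))
  have hdiv : ∀ p : ℕ, p.Prime → divAxiom p ∈ divTorsionFreeTheory :=
    fun p hp => Or.inl (Or.inr ⟨p, hp, rfl⟩)
  have htf : ∀ p : ℕ, p.Prime → torsionFreeAxiom (p ^ 1) ∈ divTorsionFreeTheory :=
    fun p hp => Or.inr ⟨p, 1, hp, rfl⟩
  refine ⟨?_, ?_, ?_, ?_, ?_, ?_, ?_, ?_⟩
  · exact hI.isOrientation (Theory.model_iff _ |>.2 fun φ hφ =>
      hLO φ (Or.inl (Or.inl (Or.inl (Or.inr hφ)))))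
  · exact fun p hp a => hI.realize_divAxiom (hLO _ (hdiv p hp)) a
  · exact fun p hp a ha => hI.realize_torsionFreeAxiom (hLO _ (htf p hp)) a (by rwa [pow_one])
  · intro p hp a _ b _ hab
    obtain ⟨c, hc⟩ := hI.realize_regDenseAxiom (hLO _ (hreg p hp)) a b hab
    exact ⟨c, AddSubgroup.mem_top c, hc⟩
  · intro p hp a ha
    obtain ⟨b, hb⟩ := hGI.realize_divAxiom (hGM _ (hdiv p hp)) ⟨a, ha⟩
    exact ⟨b, b.2, congrArg Subtype.val hb⟩
  · intro p hp a ha b hb hab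
    obtain ⟨c, hc⟩ := hGI.realize_regDenseAxiom (hGM _ (hreg p hp)) ⟨a, ha⟩ ⟨b, hb⟩ hab
    exact ⟨c, c.2, hc⟩
  · intro a b x hx
    simp only [denseAxiom, Sentence.Realize, Formula.Realize, BoundedFormula.realize_all,
      BoundedFormula.realize_imp, BoundedFormula.realize_ex, BoundedFormula.realize_inf, hpred,
      LHom.realize_onBoundedFormula, hI.realize_orientF] at hdense
    exact hdense a b ⟨x, hx⟩
  · have hcard : ∀ n : ℕ, ∃ f : Fin n → M ⧸ G, Function.Injective f := by
      intro n
      have := hindex n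
      rw [indexGeAxiom, Sentence.Realize, Formula.Realize] at this
      obtain ⟨xs, hxs⟩ := BoundedFormula.realize_exs.1 this
      simp only [BoundedFormula.realize_iInf, BoundedFormula.realize_not, hpred,
        LHom.realize_onTerm, hI.realize_addT, hI.realize_negT] at hxs
      refine ⟨fun i => (xs i : M ⧸ G), fun i j hij => ?_⟩
      by_contra hne
      -- The order `(j, i)` matches the coset relation `-xs i + xs j ∈ G`.
      refine hxs ⟨(j, i), Ne.symm hne⟩ ?_
      have := QuotientAddGroup.eq.1 hij
      rw [add_comm] at this
      exact this
    by_contra hinf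
    rw [not_infinite_iff_finite] at hinf
    obtain ⟨f, hf⟩ := hcard (Nat.card (M ⧸ G) + 1)
    have := Nat.card_le_card_of_injective f hf
    simp at this

end OrientedPairs

theorem mainTheorem10 : OrientedPairs.NIP.{0, 0, w} OrientedPairs.pairTheory := by
  intro M _ _ _ m n φ
  obtain ⟨_, O, G, hI, hA⟩ := OrientedPairs.exists_orientedPair M
  exact hI.not_hasIP hA φ
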